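/- Let $G$ be a finite undirected graph. For a sequence $S=(v_0,\dots,v_{k-1})$ of vertices let $B_0=\emptyset$ and, for $0\le t<k$, let $B_{t+1}$ consist of the vertices of $B_t$, all their neighbours, and $v_t$. The sequence $S$ is a \emph{burning sequence} of $G$ if $v_t\notin B_t$ for all $0\le t<k$ and $B_k=V(G)$; the \emph{burning number} $b(G)$ is the minimum length of a burning sequence of $G$. A \emph{cactus graph} is a graph in which any two distinct simple cycles share at most one vertex. \textbf{Theorem.} There is a polynomial-time $2.75$-approximation algorithm for Graph Burning on connected cactus graphs. That is, there are a deterministic algorithm and a polynomial $P$ such that for every $n$ and every connected cactus graph $G$ with vertex set $\{0,\dots,n-1\}$, the algorithm, given $n$ and the adjacency matrix of $G$, halts after at most $P(n)$ steps and outputs a burning sequence of $G$ of length at most $2.75\cdot b(G)$. Here algorithms are programs of a random access machine on natural numbers whose arithmetic operations are addition and truncated subtraction, every operation costing one step. -/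

import Mathlib

namespace GraphBurning

/-! ### Graph burning -/

section Burning

variable {V : Type*}

/-- The vertices that are burnt after the first `t` rounds, when the fire sources are the
entries of `S` (the entry number `t`, counted from `0`, is ignited in round `t`). In every round
each burnt vertex sets fire to its neighbours, and the source of that round is ignited. -/
def burnt (G : SimpleGraph V) (S : List V) : ℕ → Set V
  | 0 => ∅
  | t + 1 => burnt G S t ∪ {v | ∃ u ∈ burnt G S t, G.Adj u v} ∪ {v | S[t]? = some v}

/-- `S` is a burning sequence: every source is a vertex that is not burnt when its round
starts, and after the last round all vertices are burnt. -/
def IsBurningSequence (G : SimpleGraph V) (S : List V) : Prop :=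
  (∀ (t : ℕ) (ht : t < S.length), S[t] ∉ burnt G S t) ∧ burnt G S S.length = Set.univ

/-- The burning number: the minimum length of a burning sequence. -/
noncomputable def burningNumber (G : SimpleGraph V) : ℕ :=
  sInf {k | ∃ S : List V, IsBurningSequence G S ∧ S.length = k}

theorem burnt_append (G : SimpleGraph V) (S T : List V) (t : ℕ) (ht : t ≤ S.length) :
    burnt G (S ++ T) t = burnt G S t := by
  induction t with
  | zero => rfl
  | succ t ih =>
    have h : (S ++ T)[t]? = S[t]? := List.getElem?_append_left (by omega)
    simp only [burnt, ih (by omega), h]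

/-- A finite graph has a burning sequence, so the minimum in `burningNumber` is attained. -/
theorem exists_isBurningSequence [Finite V] (G : SimpleGraph V) :
    ∃ S : List V, IsBurningSequence G S := by
  by_contra hno
  push Not at hno
  have key : ∀ k : ℕ, ∃ S : List V, S.length = k ∧
      (∀ (t : ℕ) (ht : t < S.length), S[t] ∉ burnt G S t) ∧
      k ≤ (burnt G S S.length).ncard := by
    intro k
    induction k with
    | zero => exact ⟨[], rfl, by simp, by simp⟩
    | succ k ih =>
      obtain ⟨S, hk, hS, hc⟩ := ih
      have hne : burnt G S S.length ≠ Set.univ := fun h => hno S ⟨hS, h⟩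
      obtain ⟨v, hv⟩ := (Set.ne_univ_iff_exists_notMem _).1 hne
      refine ⟨S ++ [v], by simp [hk], ?_, ?_⟩
      · intro t ht
        have ht' : t ≤ S.length := by simp at ht; omega
        rw [burnt_append G S [v] t ht']
        rcases ht'.lt_or_eq with h | h
        · rw [List.getElem_append_left h]
          exact hS t h
        · subst h
          simpa using hv
      · have hsub : insert v (burnt G S S.length) ⊆
            burnt G (S ++ [v]) (S ++ [v]).length := by
          have hl : (S ++ [v]).length = S.length + 1 := by simp
          rw [hl]
          simp only [burnt, burnt_append G S [v] S.length le_rfl]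
          rintro x (rfl | hx)
          · right; simp
          · left; left; exact hx
        have := Set.ncard_le_ncard hsub (Set.toFinite _)
        rw [Set.ncard_insert_of_notMem hv (Set.toFinite _)] at this
        omega
  obtain ⟨S, hk, -, hc⟩ := key (Nat.card V + 1)
  have := Set.ncard_le_card (burnt G S S.length)
  omega

/-- A cactus graph: two different cycles have at most one vertex in common. Two closed walks
describe the same cycle if they run through the same subgraph. -/
def IsCactus (G : SimpleGraph V) : Prop :=
  ∀ ⦃u v : V⦄ (p : G.Walk u u) (q : G.Walk v v), p.IsCycle → q.IsCycle →
    p.toSubgraph ≠ q.toSubgraph →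
    ∀ ⦃x y : V⦄, x ∈ p.support → x ∈ q.support → y ∈ p.support → y ∈ q.support → x = y

end Burning

/-! ### A random access machine with a step count

Programs are while-programs over a memory of natural numbers. The only arithmetic operations
are addition and truncated subtraction, so that within `t` units of cost the numbers grow by at
most a factor `2 ^ O(t)`; with this instruction set, unit cost polynomial time is the same as
polynomial time on Turing machines. -/

/-- The memory: registers and arrays, both numbered by natural numbers. -/
@[ext] structure Memory where
  reg : ℕ → ℕ
  arr : ℕ → ℕ → ℕ

/-- Arithmetic expressions. -/
inductive Term where
  /-- a constant -/
  | const (k : ℕ)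
  /-- the content of register `x` -/
  | reg (x : ℕ)
  /-- the entry of array `a` at the index given by a term -/
  | get (a : ℕ) (i : Term)
  | add (e₁ e₂ : Term)
  | sub (e₁ e₂ : Term)

/-- The value of a term. -/
def Term.eval (m : Memory) : Term → ℕ
  | const k => k
  | reg x => m.reg x
  | get a i => m.arr a (i.eval m)
  | add e₁ e₂ => e₁.eval m + e₂.eval m
  | sub e₁ e₂ => e₁.eval m - e₂.eval m

/-- The cost of evaluating a term: one unit for every operation. -/
def Term.cost : Term → ℕ
  | const _ => 1
  | reg _ => 1
  | get _ i => i.cost + 1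
  | add e₁ e₂ => e₁.cost + e₂.cost + 1
  | sub e₁ e₂ => e₁.cost + e₂.cost + 1

/-- Programs. A test is passed if the value of the term is not `0`. -/
inductive Program where
  | skip
  /-- register `x` := value of `e` -/
  | set (x : ℕ) (e : Term)
  /-- entry of array `a` at index `i` := value of `e` -/
  | put (a : ℕ) (i e : Term)
  | seq (c₁ c₂ : Program)
  | ite (e : Term) (c₁ c₂ : Program)
  | while (e : Term) (c : Program)

/-- `Runs c m t m'`: started in memory `m`, the program `c` halts after exactly `t` units of
time, with memory `m'`. -/
inductive Runs : Program → Memory → ℕ → Memory → Prop where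
  | skip (m : Memory) : Runs .skip m 1 m
  | set (x : ℕ) (e : Term) (m : Memory) :
      Runs (.set x e) m (e.cost + 1) { m with reg := Function.update m.reg x (e.eval m) }
  | put (a : ℕ) (i e : Term) (m : Memory) :
      Runs (.put a i e) m (i.cost + e.cost + 1)
        { m with arr := Function.update m.arr a
                          (Function.update (m.arr a) (i.eval m) (e.eval m)) }
  | seq {c₁ c₂ : Program} {m m' m'' : Memory} {t₁ t₂ : ℕ} :
      Runs c₁ m t₁ m' → Runs c₂ m' t₂ m'' → Runs (.seq c₁ c₂) m (t₁ + t₂) m''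
  | ite_true {e : Term} {c₁ c₂ : Program} {m m' : Memory} {t : ℕ} :
      e.eval m ≠ 0 → Runs c₁ m t m' → Runs (.ite e c₁ c₂) m (e.cost + 1 + t) m'
  | ite_false {e : Term} {c₁ c₂ : Program} {m m' : Memory} {t : ℕ} :
      e.eval m = 0 → Runs c₂ m t m' → Runs (.ite e c₁ c₂) m (e.cost + 1 + t) m'
  | while_true {e : Term} {c : Program} {m m' m'' : Memory} {t₁ t₂ : ℕ} :
      e.eval m ≠ 0 → Runs c m t₁ m' → Runs (.while e c) m' t₂ m'' →
      Runs (.while e c) m (e.cost + 1 + t₁ + t₂) m''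
  | while_false {e : Term} {c : Program} {m : Memory} :
      e.eval m = 0 → Runs (.while e c) m (e.cost + 1) m

/-- Programs are deterministic. -/
theorem Runs.unique {c : Program} {m m₁ m₂ : Memory} {t₁ t₂ : ℕ}
    (h₁ : Runs c m t₁ m₁) (h₂ : Runs c m t₂ m₂) : t₁ = t₂ ∧ m₁ = m₂ := by
  induction h₁ generalizing t₂ m₂ with
  | skip | set | put => cases h₂; exact ⟨rfl, rfl⟩
  | seq _ _ ih₁ ih₂ =>
    cases h₂ with
    | seq a b =>
      obtain ⟨rfl, rfl⟩ := ih₁ a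
      obtain ⟨rfl, rfl⟩ := ih₂ b
      exact ⟨rfl, rfl⟩
  | ite_true he _ ih =>
    cases h₂ with
    | ite_true _ a => obtain ⟨rfl, rfl⟩ := ih a; exact ⟨rfl, rfl⟩
    | ite_false h _ => exact absurd h he
  | ite_false he _ ih =>
    cases h₂ with
    | ite_true h _ => exact absurd he h
    | ite_false _ a => obtain ⟨rfl, rfl⟩ := ih a; exact ⟨rfl, rfl⟩
  | while_true he _ _ ih₁ ih₂ =>
    cases h₂ with
    | while_true _ a b =>
      obtain ⟨rfl, rfl⟩ := ih₁ a
      obtain ⟨rfl, rfl⟩ := ih₂ b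
      exact ⟨rfl, rfl⟩
    | while_false h => exact absurd h he
  | while_false he =>
    cases h₂ with
    | while_true h _ _ => exact absurd he h
    | while_false _ => exact ⟨rfl, rfl⟩

open Classical in
/-- The input of a graph with vertex set `{0, …, n - 1}`: register `0` holds `n`, array `0`
holds the adjacency matrix row by row, everything else is `0`. -/
noncomputable def inputMemory {n : ℕ} (G : SimpleGraph (Fin n)) : Memory where
  reg x := if x = 0 then n else 0
  arr a k := if a = 0 ∧ ∃ i j : Fin n, G.Adj i j ∧ k = i * n + j then 1 else 0

/-- The output list: register `0` holds its length, array `1` holds its entries. -/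
def Memory.output (m : Memory) : List ℕ :=
  (List.range (m.reg 0)).map (m.arr 1)

end GraphBurning

/-! The algorithm is greedy. Let `b` be the burning number of a connected cactus `G`, let `m = b - 1`
and `K = ⌊11 * b / 4⌋`; a source with index `i` burns the ball of radius `K - 1 - i` around it until
time `K`. As long as some vertex is not burnt at time `K`, the algorithm picks such a vertex `v`,
as far from a root `r` as possible, and adds sources that burn, until time `K`, every vertex that
is left and has distance at most `2 * m` from `v`. Then the picks have pairwise distance more than
`2 * m`. A burning sequence of length `b` covers `G` by `b` balls of radius at most `m`, each of
which contains at most one pick, so there are at most `b` picks (`card_le_burningNumber`).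

The first `K - 2 * m` picks cost one source, namely `v` itself with a ball of radius at least
`2 * m`. Every later pick costs two sources with balls of radius at least `m`. Counting the
indices, the last of these sources has index at most `2 * b - 1 - (K - 2 * m)`, which leaves radius
at least `m` (`GreedyState.push_push`). So everything is burnt at time `K`, and since
a source is only added if it is not yet burnt, the sequence has length at most `K`.

That two balls of radius `m` suffice is where the cactus enters (`IsCactus.exists_two_balls`). Let
`X` be the set of vertices at distance `m` from `v` that have a neighbour in the component of `r`
in `G` without the ball of radius `m` around `v`. If `X` had three elements, then joining one of
them with each of the other two, through the interior of the ball and through the component, would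
give two cycles that share a vertex and one of its neighbours. So `X` has at most two elements. For
a vertex `u` with `d(r, u) ≤ d(r, v)` and `d(u, v) ≤ 2 * m`, geodesics from `r` to `u` and from `u`
to `v` form a walk from `r` to `v`, which runs through some `x ∈ X`. If `x` is on the second
geodesic, then `d(u, x) = d(u, v) - m ≤ m`; if `x` is on the first one, then
`d(u, x) = d(r, u) - d(r, x) ≤ d(r, v) - d(r, x) ≤ m`.

The burning number is not known, so all guesses are tried in increasing order. To see that the
algorithm runs in polynomial time, it is written as a transformation of the memory that is
composed of assignments and of loops of `n` rounds (`Cmd`), with expressions built from arithmetic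
and sums over all `i < n` (`Comp`), which also express bounded quantifiers and searches for the
least number. Every such transformation has a program whose running time is bounded by a
polynomial in `n`. -/

namespace GraphBurning

open SimpleGraph

/-! ### Balls in cactus graphs -/

section Cactus

variable {V : Type*} {G : SimpleGraph V}

/-- Two disjoint paths, from `a₁` to `a₂` and from `b₂` to `b₁`, are closed up to a cycle by two
further vertices `x` and `y` with `x` adjacent to `a₁`, `b₁` and `y` adjacent to `a₂`, `b₂`. -/
theorem exists_isCycle_of_disjoint_paths {x y a₁ a₂ b₁ b₂ : V}
    {p : G.Walk a₁ a₂} (hp : p.IsPath) {q : G.Walk b₂ b₁} (hq : q.IsPath)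
    (hpq : ∀ z ∈ p.support, z ∉ q.support) (hxy : x ≠ y)
    (hxp : x ∉ p.support) (hxq : x ∉ q.support) (hyp : y ∉ p.support) (hyq : y ∉ q.support)
    (hxa : G.Adj x a₁) (hay : G.Adj a₂ y) (hyb : G.Adj y b₂) (hbx : G.Adj b₁ x) :
    ∃ c : G.Walk x x, c.IsCycle ∧
      ∀ z, z ∈ c.support ↔ z = x ∨ z = y ∨ z ∈ p.support ∨ z ∈ q.support := by
  refine ⟨Walk.cons hxa (p.append (Walk.cons hay (Walk.cons hyb (q.concat hbx)))), ?_, ?_⟩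
  · rw [Walk.cons_isCycle_iff]
    constructor
    · rw [Walk.isPath_def] at hp hq ⊢
      rw [Walk.support_append, Walk.support_cons, List.tail_cons, Walk.support_cons,
        Walk.support_concat]
      simp only [List.nodup_append, List.nodup_cons, List.mem_append, List.mem_cons,
        List.not_mem_nil, or_false, List.nodup_nil]
      refine ⟨hp, ⟨?_, hq, ⟨by simp, trivial⟩, ?_⟩, ?_⟩
      · rintro (h | h)
        · exact hyq h
        · exact hxy h.symm
      · rintro z hz w rfl rfl
        exact hxq hz
      · rintro z hz w (rfl | hw | rfl) rfl
        · exact hyp hz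
        · exact hpq _ hz hw
        · exact hxp hz
    · intro h
      simp only [Walk.edges_append, Walk.edges_cons, Walk.edges_concat, List.concat_eq_append,
        List.mem_append, List.mem_cons, List.not_mem_nil, or_false] at h
      rcases h with h | h | h | h | h
      · exact hxp (Walk.fst_mem_support_of_mem_edges _ h)
      · rcases Sym2.eq_iff.1 h with ⟨rfl, -⟩ | ⟨h, -⟩
        · exact hxp p.end_mem_support
        · exact hxy h
      · rcases Sym2.eq_iff.1 h with ⟨h, -⟩ | ⟨rfl, -⟩
        · exact hxy h
        · exact hxq q.start_mem_support
      · exact hxq (Walk.fst_mem_support_of_mem_edges _ h)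
      · rcases Sym2.eq_iff.1 h with ⟨rfl, -⟩ | ⟨-, rfl⟩
        · exact hxq q.end_mem_support
        · exact hpq _ p.start_mem_support q.end_mem_support
  · intro z
    simp only [Walk.support_cons, Walk.mem_support_append_iff, Walk.support_concat,
      List.mem_append, List.mem_cons, List.not_mem_nil, or_false]
    have : z = a₂ → z ∈ p.support := by rintro rfl; exact p.end_mem_support
    tauto

/-- In a cactus, two disjoint sets `A` and `B`, each of them connected, have at most two common
neighbours outside of `A ∪ B`: a third one would give two cycles through `x₁` and its neighbour
in `A`, of which only one contains `x₂`. -/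
theorem IsCactus.no_three_common_neighbours (hG : IsCactus G) {A B : Set V}
    (hA : ∀ a ∈ A, ∀ a' ∈ A, ∃ p : G.Walk a a', ∀ z ∈ p.support, z ∈ A)
    (hB : ∀ b ∈ B, ∀ b' ∈ B, ∃ p : G.Walk b b', ∀ z ∈ p.support, z ∈ B)
    (hAB : ∀ z ∈ A, z ∉ B) {x₁ x₂ x₃ a₁ a₂ a₃ b₁ b₂ b₃ : V}
    (h12 : x₁ ≠ x₂) (h13 : x₁ ≠ x₃) (h23 : x₂ ≠ x₃)
    (hx₁ : x₁ ∉ A ∧ x₁ ∉ B) (hx₂ : x₂ ∉ A ∧ x₂ ∉ B) (hx₃ : x₃ ∉ A ∧ x₃ ∉ B)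
    (ha₁ : a₁ ∈ A ∧ G.Adj x₁ a₁) (ha₂ : a₂ ∈ A ∧ G.Adj x₂ a₂) (ha₃ : a₃ ∈ A ∧ G.Adj x₃ a₃)
    (hb₁ : b₁ ∈ B ∧ G.Adj x₁ b₁) (hb₂ : b₂ ∈ B ∧ G.Adj x₂ b₂) (hb₃ : b₃ ∈ B ∧ G.Adj x₃ b₃) :
    False := by
  classical
  have key : ∀ {y a b : V}, x₁ ≠ y → (y ∉ A ∧ y ∉ B) → (a ∈ A ∧ G.Adj y a) →
      (b ∈ B ∧ G.Adj y b) → ∃ c : G.Walk x₁ x₁, c.IsCycle ∧ a₁ ∈ c.support ∧ y ∈ c.support ∧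
        ∀ z ∈ c.support, z = x₁ ∨ z = y ∨ z ∈ A ∨ z ∈ B := by
    intro y a b hxy hy ha hb
    obtain ⟨p, hp⟩ := hA a₁ ha₁.1 a ha.1
    obtain ⟨q, hq⟩ := hB b hb.1 b₁ hb₁.1
    have hp' : ∀ z ∈ p.bypass.support, z ∈ A := fun z hz =>
      hp z (p.support_bypass_subset_support hz)
    have hq' : ∀ z ∈ q.bypass.support, z ∈ B := fun z hz =>
      hq z (q.support_bypass_subset_support hz)
    obtain ⟨c, hc, hs⟩ := exists_isCycle_of_disjoint_paths p.bypass_isPath q.bypass_isPath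
      (fun z hz hz' => hAB z (hp' z hz) (hq' z hz')) hxy
      (fun h => hx₁.1 (hp' _ h)) (fun h => hx₁.2 (hq' _ h))
      (fun h => hy.1 (hp' _ h)) (fun h => hy.2 (hq' _ h))
      ha₁.2 ha.2.symm hb.2 hb₁.2.symm
    refine ⟨c, hc, (hs _).2 (.inr (.inr (.inl (Walk.start_mem_support _)))),
      (hs _).2 (.inr (.inl rfl)), fun z hz => ?_⟩
    rcases (hs z).1 hz with h | h | h | h
    · exact .inl h
    · exact .inr (.inl h)
    · exact .inr (.inr (.inl (hp' z h)))
    · exact .inr (.inr (.inr (hq' z h)))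
  obtain ⟨c, hc, hac, hyc, -⟩ := key h12 hx₂ ha₂ hb₂
  obtain ⟨d, hd, had, -, hsd⟩ := key h13 hx₃ ha₃ hb₃
  have hne : c.toSubgraph ≠ d.toSubgraph := by
    intro h
    have : x₂ ∈ d.support := by
      rw [← Walk.mem_verts_toSubgraph, ← h, Walk.mem_verts_toSubgraph]
      exact hyc
    rcases hsd x₂ this with h | h | h | h
    · exact h12 h.symm
    · exact h23 h
    · exact hx₂.1 h
    · exact hx₂.2 h
  exact ha₁.2.ne (hG c d hc hd hne c.start_mem_support d.start_mem_support hac had)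

/-- Distances add up along a geodesic. -/
theorem dist_add_dist_of_mem_support (hG : G.Connected) {u v z : V} {p : G.Walk u v}
    (hp : p.length = G.dist u v) (hz : z ∈ p.support) :
    G.dist u z + G.dist z v = G.dist u v := by
  classical
  have h1 := dist_le (p.takeUntil z hz)
  have h2 := dist_le (p.dropUntil z hz)
  have h3 := congrArg Walk.length (p.take_spec hz)
  rw [Walk.length_append] at h3
  have := hG.dist_triangle (u := u) (v := z) (w := v)
  omega

/-- In a connected cactus, at most two vertices at distance `m` from `v` have a neighbour in the
part of `G` that can be reached from `r` while staying at distance more than `m` from `v`;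
hence every walk from `r` to `v` runs through one of at most two vertices at distance `m`
from `v`. -/
theorem IsCactus.exists_separating_pair (hG : G.Connected) (hc : IsCactus G) {r v : V} {m : ℕ}
    (hr : m < G.dist v r) :
    ∃ x₁ x₂ : V, ∀ p : G.Walk r v, ∃ x ∈ p.support, (x = x₁ ∨ x = x₂) ∧ G.dist v x = m := by
  classical
  set A : Set V := {w | G.dist v w < m} with hAdef
  set B : Set V := {w | ∃ p : G.Walk r w, ∀ z ∈ p.support, m < G.dist v z} with hBdef
  set X : Set V := {x | G.dist v x = m ∧ ∃ b ∈ B, G.Adj x b} with hXdef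
  have hsep : ∀ p : G.Walk r v, ∃ x ∈ p.support, x ∈ X := by
    intro p
    obtain ⟨d, hd, h1, h2⟩ := p.exists_boundary_dart B ⟨Walk.nil, by simpa using hr⟩ (by
      rintro ⟨q, hq⟩
      have := hq v q.end_mem_support
      simp at this)
    refine ⟨d.snd, p.dart_snd_mem_support_of_mem_darts hd, ?_, d.fst, h1, d.adj.symm⟩
    obtain ⟨q, hq⟩ := h1
    have h3 : ¬ m < G.dist v d.snd := by
      intro h
      refine h2 ⟨q.concat d.adj, fun z hz => ?_⟩
      rw [Walk.support_concat, List.mem_append, List.mem_singleton] at hz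
      rcases hz with hz | rfl
      · exact hq z hz
      · exact h
    have h4 := hq _ q.end_mem_support
    have h5 := hG.dist_triangle (u := v) (v := d.snd) (w := d.fst)
    rw [dist_eq_one_iff_adj.2 d.adj.symm] at h5
    omega
  suffices h : ∃ x₁ x₂ : V, ∀ x ∈ X, x = x₁ ∨ x = x₂ by
    obtain ⟨x₁, x₂, h⟩ := h
    refine ⟨x₁, x₂, fun p => ?_⟩
    obtain ⟨x, hxp, hx⟩ := hsep p
    exact ⟨x, hxp, h x hx, hx.1⟩
  by_contra hno
  push Not at hno
  obtain ⟨x₁, hx₁, -⟩ := hno r r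
  obtain ⟨x₂, hx₂, h12, -⟩ := hno x₁ x₁
  obtain ⟨x₃, hx₃, h13, h23⟩ := hno x₁ x₂
  have hm : m ≠ 0 := by
    intro h0
    have e1 := (hG.dist_eq_zero_iff).1 (hx₁.1.trans h0)
    have e2 := (hG.dist_eq_zero_iff).1 (hx₂.1.trans h0)
    exact h12 (e2.symm.trans e1)
  have hin : ∀ x ∈ X, x ∉ A ∧ x ∉ B := by
    intro x hx
    refine ⟨fun h => (h.trans_eq hx.1.symm).false, ?_⟩
    rintro ⟨p, hp⟩
    have := hp x p.end_mem_support
    rw [hx.1] at this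
    exact this.false
  have hnb : ∀ x ∈ X, ∃ a, a ∈ A ∧ G.Adj x a := by
    intro x hx
    obtain ⟨p, hp⟩ := hG.exists_walk_length_eq_dist x v
    cases p with
    | nil => exact absurd (hx.1.symm.trans (by simp)) hm
    | cons h q =>
      refine ⟨_, ?_, h⟩
      have h1 := dist_le q
      rw [Walk.length_cons, SimpleGraph.dist_comm, hx.1] at hp
      rw [SimpleGraph.dist_comm] at h1
      simp only [hAdef, Set.mem_ofPred_eq]
      omega
  have hAc : ∀ a ∈ A, ∃ p : G.Walk a v, ∀ z ∈ p.support, z ∈ A := by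
    intro a ha
    obtain ⟨p, hp⟩ := hG.exists_walk_length_eq_dist a v
    refine ⟨p, fun z hz => ?_⟩
    have := dist_add_dist_of_mem_support hG hp hz
    rw [SimpleGraph.dist_comm (u := z), SimpleGraph.dist_comm (u := a) (v := v)] at this
    simp only [hAdef, Set.mem_ofPred_eq] at ha ⊢
    omega
  have hBc : ∀ b ∈ B, ∃ p : G.Walk r b, ∀ z ∈ p.support, z ∈ B := by
    rintro b ⟨p, hp⟩
    exact ⟨p, fun z hz => ⟨p.takeUntil z hz, fun y hy =>
      hp y (p.support_takeUntil_subset_support hz hy)⟩⟩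
  obtain ⟨a₁, ha₁⟩ := hnb x₁ hx₁
  obtain ⟨a₂, ha₂⟩ := hnb x₂ hx₂
  obtain ⟨a₃, ha₃⟩ := hnb x₃ hx₃
  obtain ⟨-, b₁, hb₁⟩ := id hx₁
  obtain ⟨-, b₂, hb₂⟩ := id hx₂
  obtain ⟨-, b₃, hb₃⟩ := id hx₃
  refine hc.no_three_common_neighbours (A := A) (B := B) ?_ ?_ ?_ h12.symm h13.symm h23.symm
    (hin _ hx₁) (hin _ hx₂) (hin _ hx₃) ha₁ ha₂ ha₃ hb₁ hb₂ hb₃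
  · intro a ha a' ha'
    obtain ⟨p, hp⟩ := hAc a ha
    obtain ⟨q, hq⟩ := hAc a' ha'
    refine ⟨p.append q.reverse, fun z hz => ?_⟩
    rw [Walk.mem_support_append_iff, Walk.support_reverse, List.mem_reverse] at hz
    exact hz.elim (hp z) (hq z)
  · intro a ha a' ha'
    obtain ⟨p, hp⟩ := hBc a ha
    obtain ⟨q, hq⟩ := hBc a' ha'
    refine ⟨p.reverse.append q, fun z hz => ?_⟩
    rw [Walk.mem_support_append_iff, Walk.support_reverse, List.mem_reverse] at hz
    exact hz.elim (hp z) (hq z)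
  · rintro z hz ⟨p, hp⟩
    exact (hz.trans (hp z p.end_mem_support)).false

/-- In a connected cactus, the vertices that are at distance at most `2 * m` from `v` and not
farther from `r` than `v` are covered by two balls of radius `m`. -/
theorem IsCactus.exists_two_balls (hG : G.Connected) (hc : IsCactus G) (r v : V) (m : ℕ) :
    ∃ x₁ x₂ : V, ∀ u, G.dist r u ≤ G.dist r v → G.dist u v ≤ 2 * m →
      G.dist u x₁ ≤ m ∨ G.dist u x₂ ≤ m := by
  by_cases hr : G.dist v r ≤ m
  · refine ⟨r, r, fun u hu _ => .inl ?_⟩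
    rw [SimpleGraph.dist_comm] at hr
    rw [SimpleGraph.dist_comm]
    omega
  obtain ⟨x₁, x₂, h⟩ := hc.exists_separating_pair hG (not_le.1 hr)
  refine ⟨x₁, x₂, fun u hu huv => ?_⟩
  obtain ⟨p, hp⟩ := hG.exists_walk_length_eq_dist r u
  obtain ⟨q, hq⟩ := hG.exists_walk_length_eq_dist u v
  obtain ⟨x, hx, hx', hxm⟩ := h (p.append q)
  suffices G.dist u x ≤ m by
    rcases hx' with rfl | rfl
    · exact .inl this
    · exact .inr this
  rw [Walk.mem_support_append_iff] at hx
  rw [SimpleGraph.dist_comm] at hxm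
  rcases hx with hx | hx
  · have h1 := dist_add_dist_of_mem_support hG hp hx
    have h2 := hG.dist_triangle (u := r) (v := x) (w := v)
    rw [SimpleGraph.dist_comm (u := x) (v := u)] at h1
    omega
  · have h1 := dist_add_dist_of_mem_support hG hq hx
    omega

end Cactus
/-! ### Burning sequences in terms of distances -/

section Greedy

variable {V : Type*} {G : SimpleGraph V}

/-- The set burnt at time `t` is the union of the balls of radius `t - 1 - j` around the sources
with index `j < t`. -/
theorem mem_burnt_iff (hG : G.Connected) {S : List V} {t : ℕ} {u : V} :
    u ∈ burnt G S t ↔ ∃ j s, S[j]? = some s ∧ G.dist s u + j + 1 ≤ t := by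
  induction t generalizing u with
  | zero => simp [burnt]
  | succ t ih =>
    simp only [burnt, Set.mem_union, Set.mem_ofPred_eq, ih]
    constructor
    · rintro ((⟨j, s, hs, h⟩ | ⟨w, ⟨j, s, hs, h⟩, hw⟩) | h)
      · exact ⟨j, s, hs, by omega⟩
      · have h1 := hG.dist_triangle (u := s) (v := w) (w := u)
        rw [dist_eq_one_iff_adj.2 hw] at h1
        exact ⟨j, s, hs, by omega⟩
      · exact ⟨t, u, h, by simp⟩
    · rintro ⟨j, s, hs, h⟩
      by_cases h1 : G.dist s u + j + 1 ≤ t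
      · exact .inl (.inl ⟨j, s, hs, h1⟩)
      obtain ⟨p, hp⟩ := hG.exists_walk_length_eq_dist u s
      rw [SimpleGraph.dist_comm] at hp
      cases p with
      | nil =>
        refine .inr ?_
        have : j = t := by simp at h h1; omega
        rwa [← this]
      | @cons _ w _ hw q =>
        refine .inl (.inr ⟨w, ⟨j, s, hs, ?_⟩, hw.symm⟩)
        have := dist_le q
        rw [Walk.length_cons] at hp
        rw [SimpleGraph.dist_comm] at this
        omega

theorem mem_burnt_append (hG : G.Connected) {S T : List V} {t : ℕ} {u : V}
    (hu : u ∈ burnt G S t) : u ∈ burnt G (S ++ T) t := by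
  rw [mem_burnt_iff hG] at hu ⊢
  obtain ⟨j, s, hs, h⟩ := hu
  refine ⟨j, s, ?_, h⟩
  rw [List.getElem?_append_left (List.getElem?_eq_some_iff.1 hs).1]
  exact hs

/-- Every source is a vertex that is not burnt when its round starts. -/
def IsValid (G : SimpleGraph V) (S : List V) : Prop :=
  ∀ (t : ℕ) (ht : t < S.length), S[t] ∉ burnt G S t

theorem isValid_nil : IsValid G [] := by
  intro t ht
  simp at ht

theorem IsValid.append_singleton {S : List V} (hS : IsValid G S) {x : V}
    (hx : x ∉ burnt G S S.length) : IsValid G (S ++ [x]) := by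
  intro t ht
  have ht' : t ≤ S.length := by simp at ht; omega
  rw [burnt_append G S [x] t ht']
  rcases ht'.lt_or_eq with h | h
  · rw [List.getElem_append_left h]
    exact hS t h
  · subst h
    simpa using hx

theorem IsValid.nodup (hG : G.Connected) {S : List V} (hS : IsValid G S) : S.Nodup := by
  rw [List.nodup_iff_pairwise_ne, List.pairwise_iff_getElem]
  intro i j hi hj hij h
  refine hS j hj ((mem_burnt_iff hG).2 ⟨i, S[i], List.getElem?_eq_getElem hi, ?_⟩)
  rw [h, SimpleGraph.dist_self]
  omega

theorem IsValid.length_le_card [Fintype V] (hG : G.Connected) {S : List V} (hS : IsValid G S) :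
    S.length ≤ Fintype.card V := by
  classical
  exact (hS.nodup hG).length_le_card

theorem IsValid.length_le {S : List V} (hS : IsValid G S) {K : ℕ} (hK : ∀ u, u ∈ burnt G S K) :
    S.length ≤ K := by
  by_contra! h
  exact hS K h (hK _)

theorem exists_isBurningSequence_length_eq [Finite V] (G : SimpleGraph V) :
    ∃ S : List V, IsBurningSequence G S ∧ S.length = burningNumber G := by
  obtain ⟨S, hS⟩ := exists_isBurningSequence G
  exact Nat.sInf_mem (s := {k | ∃ S : List V, IsBurningSequence G S ∧ S.length = k})
    ⟨_, S, hS, rfl⟩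

theorem burningNumber_le_card [Fintype V] (hG : G.Connected) :
    burningNumber G ≤ Fintype.card V := by
  obtain ⟨S, hS, hb⟩ := exists_isBurningSequence_length_eq G
  exact hb ▸ IsValid.length_le_card hG hS.1

/-- Vertices that have pairwise distance more than `2 * (b - 1)` are burnt by different sources
of a burning sequence of length `b`, so there are at most `b` of them. -/
theorem card_le_burningNumber [Finite V] (hG : G.Connected) {W : Finset V}
    (hW : ∀ w ∈ W, ∀ w' ∈ W, w ≠ w' → 2 * (burningNumber G - 1) < G.dist w w') :
    W.card ≤ burningNumber G := by
  classical
  obtain ⟨S, hS, hb⟩ := exists_isBurningSequence_length_eq G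
  have h : ∀ u, ∃ j s, S[j]? = some s ∧ G.dist s u + j + 1 ≤ S.length := fun u =>
    (mem_burnt_iff hG).1 (hS.2 ▸ Set.mem_univ u)
  choose f s hs hf using h
  rw [← Finset.card_range (burningNumber G)]
  refine Finset.card_le_card_of_injOn f (fun w _ => ?_) fun w hw w' hw' hff => ?_
  · have := hf w
    simp only [Finset.coe_range, Set.mem_Iio]
    omega
  · by_contra hne
    have h1 := hW w hw w' hw' hne
    have h2 : s w = s w' := by
      have := hs w
      rw [hff, hs w'] at this
      exact (Option.some.inj this).symm
    have h3 := hf w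
    have h4 := hf w'
    have h5 := hG.dist_triangle (u := w) (v := s w') (w := w')
    rw [h2, SimpleGraph.dist_comm] at h3
    omega

theorem pairwise_insert [DecidableEq V] {W : Finset V} {v : V} {k : ℕ}
    (hW : ∀ w ∈ W, ∀ w' ∈ W, w ≠ w' → k < G.dist w w') (hv : ∀ w ∈ W, k < G.dist v w) :
    ∀ w ∈ insert v W, ∀ w' ∈ insert v W, w ≠ w' → k < G.dist w w' := by
  intro w hw w' hw' hne
  rcases Finset.mem_insert.1 hw with rfl | h
  · rcases Finset.mem_insert.1 hw' with rfl | hw'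
    · exact absurd rfl hne
    · exact hv _ hw'
  · rcases Finset.mem_insert.1 hw' with rfl | h'
    · rw [SimpleGraph.dist_comm]
      exact hv _ h
    · exact hW _ h _ h' hne

/-! ### The greedy choice of the sources -/

open Classical in
/-- Append a source unless it is burnt already when its round starts. -/
noncomputable def push (G : SimpleGraph V) (S : List V) (x : V) : List V :=
  if x ∈ burnt G S S.length then S else S ++ [x]

theorem length_le_length_push (S : List V) (x : V) : S.length ≤ (push G S x).length := by
  unfold push
  split_ifs <;> simp

theorem length_push_le (S : List V) (x : V) : (push G S x).length ≤ S.length + 1 := by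
  unfold push
  split_ifs <;> simp

theorem mem_burnt_push (hG : G.Connected) {S : List V} {x u : V} {t : ℕ}
    (hu : u ∈ burnt G S t) : u ∈ burnt G (push G S x) t := by
  unfold push
  split_ifs
  · exact hu
  · exact mem_burnt_append hG hu

/-- Pushing `x` makes sure that the ball of radius `K - 1 - S.length` around `x` is burnt at
time `K`, also in the case that `x` is left out. -/
theorem mem_burnt_push_of_dist_le (hG : G.Connected) {S : List V} {x u : V} {K : ℕ}
    (h : G.dist u x + S.length + 1 ≤ K) : u ∈ burnt G (push G S x) K := by
  unfold push
  split_ifs with hx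
  · rw [mem_burnt_iff hG] at hx ⊢
    obtain ⟨j, s, hs, hj⟩ := hx
    have := hG.dist_triangle (u := s) (v := x) (w := u)
    rw [SimpleGraph.dist_comm (u := x)] at this
    exact ⟨j, s, hs, by omega⟩
  · refine (mem_burnt_iff hG).2 ⟨S.length, x, by simp, ?_⟩
    rwa [SimpleGraph.dist_comm]

/-- The state of the greedy algorithm with the guess `g` for the burning number after `j` picks,
if `S` is the list of sources: unless `S` burns everything within time `11 * g / 4`, the picks are
pairwise at distance more than `2 * (g - 1)`, also from every vertex that is not yet burnt at time
`11 * g / 4`. In the beginning every pick costs one source, namely as long as its ball has radius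
at least `2 * (g - 1)`; afterwards it costs at most two. -/
def GreedyState (G : SimpleGraph V) (g j : ℕ) (S : List V) : Prop :=
  (∀ u, u ∈ burnt G S (11 * g / 4)) ∨
    ∃ W : Finset V, W.card = j ∧
      (∀ w ∈ W, ∀ w' ∈ W, w ≠ w' → 2 * (g - 1) < G.dist w w') ∧
      (∀ u ∉ burnt G S (11 * g / 4), ∀ w ∈ W, 2 * (g - 1) < G.dist u w) ∧
      (S.length = j ∧ j + 2 * (g - 1) ≤ 11 * g / 4 ∨
        11 * g / 4 ≤ S.length + 2 * (g - 1) ∧ S.length + 11 * g / 4 ≤ 2 * j + 2 * (g - 1))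

theorem greedyState_nil {g : ℕ} : GreedyState G g 0 [] :=
  .inr ⟨∅, by simp, by simp, by simp, .inl ⟨rfl, by omega⟩⟩

/-- The vertices `x₁`, `x₂` are an admissible choice for the next sources, if `v` is the next
pick. -/
def IsChoice (G : SimpleGraph V) (g : ℕ) (S : List V) (v x₁ x₂ : V) : Prop :=
  if 2 * (g - 1) + S.length + 1 ≤ 11 * g / 4 then x₁ = v ∧ x₂ = v
  else ∀ u ∉ burnt G S (11 * g / 4), G.dist u v ≤ 2 * (g - 1) →
    G.dist u x₁ ≤ g - 1 ∨ G.dist u x₂ ≤ g - 1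

/-- A pick that is not yet burnt at time `11 * b(G) / 4`, together with an admissible choice of
sources, leads to the next state. In the late phase, as there are at most `b(G)` picks, both
sources come early enough to have balls of radius at least `b(G) - 1`. -/
theorem GreedyState.push_push [Finite V] (hG : G.Connected) {j : ℕ} {S : List V}
    (h : GreedyState G (burningNumber G) j S) {v x₁ x₂ : V}
    (hv : v ∉ burnt G S (11 * burningNumber G / 4))
    (hx : IsChoice G (burningNumber G) S v x₁ x₂) :
    GreedyState G (burningNumber G) (j + 1) (push G (push G S x₁) x₂) := by
  classical
  rcases h with h | ⟨W, hj, hW, hU, hlen⟩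
  · exact absurd (h v) hv
  have hvW : v ∉ W := fun hvW => by simpa using hU v hv v hvW
  have hW' := pairwise_insert hW (hU v hv)
  have hcard := card_le_burningNumber hG hW'
  have hcard' : (insert v W).card = j + 1 := by rw [Finset.card_insert_of_notMem hvW, hj]
  rw [hcard'] at hcard
  refine .inr ⟨insert v W, hcard', hW', ?_, ?_⟩
  · intro u hu w hw
    have hu1 : u ∉ burnt G (push G S x₁) (11 * burningNumber G / 4) := fun h =>
      hu (mem_burnt_push hG h)
    have hu0 : u ∉ burnt G S (11 * burningNumber G / 4) := fun h => hu1 (mem_burnt_push hG h)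
    rcases Finset.mem_insert.1 hw with rfl | hw
    · by_contra! hd
      unfold IsChoice at hx
      split_ifs at hx with hc
      · obtain ⟨rfl, rfl⟩ := hx
        exact hu1 (mem_burnt_push_of_dist_le hG (by omega))
      · have hl := length_push_le (G := G) S x₁
        rcases hx u hu0 hd with hd | hd
        · exact hu1 (mem_burnt_push_of_dist_le hG (by omega))
        · exact hu (mem_burnt_push_of_dist_le hG (by omega))
    · exact hU u hu0 w hw
  · unfold IsChoice at hx
    split_ifs at hx with hc
    · obtain ⟨rfl, rfl⟩ := hx
      have h1 : x₂ ∉ burnt G S S.length := by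
        intro h
        refine hv ?_
        rw [mem_burnt_iff hG] at h ⊢
        obtain ⟨i, s, hs, hi⟩ := h
        exact ⟨i, s, hs, by omega⟩
      have h2 : push G S x₂ = S ++ [x₂] := if_neg h1
      have h3 : push G (push G S x₂) x₂ = S ++ [x₂] := by
        rw [h2]
        refine if_pos ((mem_burnt_iff hG).2 ⟨S.length, x₂, by simp, by simp⟩)
      rw [h3, List.length_append, List.length_singleton]
      omega
    · have h1 := length_push_le (G := G) S x₁
      have h2 := length_push_le (G := G) (push G S x₁) x₂
      have h3 := length_le_length_push (G := G) S x₁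
      have h4 := length_le_length_push (G := G) (push G S x₁) x₂
      omega

/-- After `b(G)` picks everything is burnt at time `11 * b(G) / 4`. -/
theorem GreedyState.forall_mem [Finite V] (hG : G.Connected) {j : ℕ} {S : List V}
    (h : GreedyState G (burningNumber G) j S) (hj : burningNumber G ≤ j) (u : V) :
    u ∈ burnt G S (11 * burningNumber G / 4) := by
  classical
  rcases h with h | ⟨W, hc, hW, hU, -⟩
  · exact h u
  by_contra hu
  have huW : u ∉ W := fun huW => by simpa using hU u hu u huW
  have hW' := pairwise_insert hW (hU u hu)
  have hcard := card_le_burningNumber hG hW'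
  rw [Finset.card_insert_of_notMem huW] at hcard
  omega

end Greedy
/-! ### Expressions computable in polynomial time -/

section Expressions

/-- The memories `m` and `m'` have the same arrays and the same registers below `k`. The registers
from `k` on are scratch space. -/
def Agree (k : ℕ) (m m' : Memory) : Prop :=
  m'.arr = m.arr ∧ ∀ x < k, m'.reg x = m.reg x

theorem Agree.refl (k : ℕ) (m : Memory) : Agree k m m := ⟨rfl, fun _ _ => rfl⟩

theorem Agree.trans {k : ℕ} {m₁ m₂ m₃ : Memory} (h : Agree k m₁ m₂) (h' : Agree k m₂ m₃) :
    Agree k m₁ m₃ :=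
  ⟨h'.1.trans h.1, fun x hx => (h'.2 x hx).trans (h.2 x hx)⟩

theorem Agree.mono {k k' : ℕ} (hk : k ≤ k') {m m' : Memory} (h : Agree k' m m') :
    Agree k m m' :=
  ⟨h.1, fun x hx => h.2 x (hx.trans_le hk)⟩

/-- Set register `x` to `v`. -/
def Memory.setReg (m : Memory) (x v : ℕ) : Memory :=
  { m with reg := Function.update m.reg x v }

/-- Set the entry of array `a` at index `i` to `v`. -/
def Memory.setArr (m : Memory) (a i v : ℕ) : Memory :=
  { m with arr := Function.update m.arr a (Function.update (m.arr a) i v) }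

@[simp] theorem Memory.setReg_arr (m : Memory) (x v : ℕ) : (m.setReg x v).arr = m.arr := rfl

@[simp] theorem Memory.setReg_reg_self (m : Memory) (x v : ℕ) : (m.setReg x v).reg x = v := by
  simp [Memory.setReg]

theorem Memory.setReg_reg_of_ne (m : Memory) {x y : ℕ} (h : y ≠ x) (v : ℕ) :
    (m.setReg x v).reg y = m.reg y := by
  simp [Memory.setReg, h]

@[simp] theorem Memory.setArr_reg (m : Memory) (a i v : ℕ) : (m.setArr a i v).reg = m.reg := rfl

theorem Memory.setArr_arr (m : Memory) (a i v b j : ℕ) :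
    (m.setArr a i v).arr b j = if b = a ∧ j = i then v else m.arr b j := by
  by_cases hb : b = a
  · subst hb
    by_cases hj : j = i <;> simp [Memory.setArr, hj]
  · simp [Memory.setArr, hb]

theorem agree_setReg {k x : ℕ} (hx : k ≤ x) (m : Memory) (v : ℕ) : Agree k m (m.setReg x v) :=
  ⟨rfl, fun _ hy => m.setReg_reg_of_ne (by omega) v⟩

theorem Agree.setReg {k : ℕ} {m m' : Memory} (h : Agree k m m') (x v : ℕ) :
    Agree k (m.setReg x v) (m'.setReg x v) := by
  refine ⟨h.1, fun y hy => ?_⟩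
  by_cases hyx : y = x
  · subst hyx
    simp
  · rw [m'.setReg_reg_of_ne hyx, m.setReg_reg_of_ne hyx, h.2 y hy]

theorem Agree.setArr {k : ℕ} {m m' : Memory} (h : Agree k m m') (a i v : ℕ) :
    Agree k (m.setArr a i v) (m'.setArr a i v) := by
  refine ⟨?_, h.2⟩
  simp only [Memory.setArr, h.1]

/-- A context: a type `Γ` of values that is represented in the memory, in such a way that
registers from `k` on do not matter, register `0` holds the size of the input and the arrays
belong to the value. Expressions are functions on `Γ`. -/
structure Context (Γ : Type) where
  k : ℕ
  pos : 0 < k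
  rep : Memory → Γ → Prop
  size : Γ → ℕ
  arr : Γ → ℕ → ℕ → ℕ
  reg_zero : ∀ {m γ}, rep m γ → m.reg 0 = size γ
  arr_eq : ∀ {m γ}, rep m γ → m.arr = arr γ
  rep_of_agree : ∀ {m m' γ}, Agree k m m' → rep m γ → rep m' γ

/-- The context extended by one variable, which is held in register `k`. -/
def Context.extend {Γ : Type} (C : Context Γ) (k : ℕ) (hk : C.k ≤ k) : Context (Γ × ℕ) where
  k := k + 1
  pos := k.succ_pos
  rep m p := C.rep m p.1 ∧ m.reg k = p.2
  size p := C.size p.1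
  arr p := C.arr p.1
  reg_zero h := C.reg_zero h.1
  arr_eq h := C.arr_eq h.1
  rep_of_agree h h' := ⟨C.rep_of_agree (h.mono (hk.trans k.le_succ)) h'.1,
    (h.2 k k.lt_succ_self).trans h'.2⟩

/-- The context of commands: the value is the memory up to scratch registers. -/
def Context.base (k : ℕ) (hk : 0 < k) : Context Memory where
  k := k
  pos := hk
  rep m γ := Agree k γ m
  size γ := γ.reg 0
  arr γ := γ.arr
  reg_zero h := h.2 0 hk
  arr_eq h := h.1
  rep_of_agree h h' := h'.trans h

/-- The expression `F` can be evaluated in polynomial time: for every `k` beyond the registers in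
use there is a program that writes the value to register `k` and changes nothing else but
registers beyond `k`. -/
def Comp {Γ : Type} (C : Context Γ) (F : Γ → ℕ) : Prop :=
  ∀ k, C.k ≤ k → ∃ (c : Program) (P : Polynomial ℕ), ∀ m γ, C.rep m γ →
    ∃ t m', Runs c m t m' ∧ t ≤ P.eval (m.reg 0) ∧ Agree k m m' ∧ m'.reg k = F γ

variable {Γ Δ : Type} {C : Context Γ} {F F' : Γ → ℕ}

theorem Runs.setReg (x : ℕ) (e : Term) (m : Memory) :
    Runs (.set x e) m (e.cost + 1) (m.setReg x (e.eval m)) :=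
  Runs.set x e m

theorem Runs.setArr (a : ℕ) (i e : Term) (m : Memory) :
    Runs (.put a i e) m (i.cost + e.cost + 1) (m.setArr a (i.eval m) (e.eval m)) :=
  Runs.put a i e m

/-- A loop that counts register `x` from `i` up to the content `n` of register `0`. -/
theorem exists_runs_while {x n T : ℕ} {c : Program} {I : ℕ → Memory → Prop}
    (hI : ∀ i m, I i m → m.reg 0 = n ∧ m.reg x = i)
    (hc : ∀ i m, i < n → I i m → ∃ t m', Runs c m t m' ∧ t ≤ T ∧ I (i + 1) m') :
    ∀ d i m, i + d = n → I i m →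
      ∃ t m', Runs (.while (.sub (.reg 0) (.reg x)) c) m t m' ∧ t ≤ d * (T + 4) + 4 ∧ I n m' := by
  intro d
  induction d with
  | zero =>
    intro i m hi h
    obtain ⟨h0, hx⟩ := hI i m h
    obtain rfl : i = n := hi
    exact ⟨_, m, .while_false (by simp [Term.eval, h0, hx]), by simp [Term.cost], h⟩
  | succ d ih =>
    intro i m hi h
    obtain ⟨h0, hx⟩ := hI i m h
    obtain ⟨t, m', h1, h2, h3⟩ := hc i m (by omega) h
    obtain ⟨t', m'', h1', h2', h3'⟩ := ih (i + 1) m' (by omega) h3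
    refine ⟨_, m'', .while_true (by simp only [Term.eval, h0, hx]; omega) h1 h1', ?_, h3'⟩
    simp only [Term.cost]
    linarith

theorem Comp.comap {D : Context Δ} (h : Comp C F) (φ : Δ → Γ) (hk : C.k ≤ D.k)
    (hφ : ∀ m δ, D.rep m δ → C.rep m (φ δ)) : Comp D (fun δ => F (φ δ)) := by
  intro k hk'
  obtain ⟨c, P, hc⟩ := h k (hk.trans hk')
  exact ⟨c, P, fun m δ hm => hc m (φ δ) (hφ m δ hm)⟩

/-- Weakening: an expression may be used in an extended context. -/
theorem Comp.wk (h : Comp C F) {k : ℕ} {hk : C.k ≤ k} :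
    Comp (C.extend k hk) (fun p => F p.1) :=
  h.comap Prod.fst (hk.trans k.le_succ) fun _ _ h => h.1

theorem Comp.of_term (e : ℕ → Term)
    (h : ∀ k m γ, C.k ≤ k → C.rep m γ → (e k).eval m = F γ) : Comp C F := by
  intro k hk
  refine ⟨.set k (e k), Polynomial.C ((e k).cost + 1), fun m γ hm =>
    ⟨_, _, Runs.setReg _ _ _, by simp, agree_setReg le_rfl _ _, ?_⟩⟩
  rw [Memory.setReg_reg_self, h k m γ hk hm]

theorem Comp.const (a : ℕ) : Comp C (fun _ => a) :=
  .of_term (fun _ => .const a) fun _ _ _ _ _ => rfl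

theorem Comp.size : Comp C C.size :=
  .of_term (fun _ => .reg 0) fun _ _ _ _ h => C.reg_zero h

/-- The variable by which the context was extended last. -/
theorem Comp.var {k : ℕ} {hk : C.k ≤ k} : Comp (C.extend k hk) (fun p => p.2) :=
  .of_term (fun _ => .reg k) fun _ _ _ _ h => h.2

theorem Comp.reg {k : ℕ} {hk : 0 < k} (x : ℕ) (hx : x < k) :
    Comp (Context.base k hk) (fun m => m.reg x) :=
  .of_term (fun _ => .reg x) fun _ _ _ _ h => h.2 x hx

theorem Comp.get (a : ℕ) (h : Comp C F) : Comp C (fun γ => C.arr γ a (F γ)) := by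
  intro k hk
  obtain ⟨c, P, hc⟩ := h k hk
  refine ⟨.seq c (.set k (.get a (.reg k))), P + 3, fun m γ hm => ?_⟩
  obtain ⟨t, m', h1, h2, h3, h4⟩ := hc m γ hm
  refine ⟨_, _, h1.seq (Runs.setReg _ _ _), ?_, h3.trans (agree_setReg le_rfl _ _), ?_⟩
  · simp only [Term.cost, Polynomial.eval_add, Polynomial.eval_ofNat]
    omega
  · simp only [Memory.setReg_reg_self, Term.eval]
    rw [h4, h3.1, C.arr_eq hm]

/-- Two expressions are evaluated one after the other, and then combined. -/
theorem Comp.combine (h : Comp C F) (h' : Comp C F') (op : Term → Term → Term) (f : ℕ → ℕ → ℕ)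
    (hop : ∀ m a b, (op a b).eval m = f (a.eval m) (b.eval m))
    (hcost : ∀ a b, (op a b).cost = a.cost + b.cost + 1) :
    Comp C (fun γ => f (F γ) (F' γ)) := by
  intro k hk
  obtain ⟨c, P, hc⟩ := h k hk
  obtain ⟨c', P', hc'⟩ := h' (k + 1) (by omega)
  refine ⟨.seq c (.seq c' (.set k (op (.reg k) (.reg (k + 1))))), P + P' + 4, fun m γ hm => ?_⟩
  obtain ⟨t, m', h1, h2, h3, h4⟩ := hc m γ hm
  obtain ⟨t', m'', h1', h2', h3', h4'⟩ := hc' m' γ (C.rep_of_agree (h3.mono hk) hm)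
  refine ⟨_, _, h1.seq (h1'.seq (Runs.setReg _ _ _)), ?_,
    (h3.trans (h3'.mono k.le_succ)).trans (agree_setReg le_rfl _ _), ?_⟩
  · rw [h3.2 0 (C.pos.trans_le hk)] at h2'
    simp only [hcost, Term.cost, Polynomial.eval_add, Polynomial.eval_ofNat]
    omega
  · simp only [Memory.setReg_reg_self, hop, Term.eval]
    rw [h4', h3'.2 k k.lt_succ_self, h4]

theorem Comp.add (h : Comp C F) (h' : Comp C F') : Comp C (fun γ => F γ + F' γ) :=
  h.combine h' .add (· + ·) (fun _ _ _ => rfl) fun _ _ => rfl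

theorem Comp.sub (h : Comp C F) (h' : Comp C F') : Comp C (fun γ => F γ - F' γ) :=
  h.combine h' .sub (· - ·) (fun _ _ _ => rfl) fun _ _ => rfl

theorem Comp.sum {F : ℕ → Γ → ℕ}
    (h : ∀ k hk, Comp (C.extend k hk) (fun p => F p.2 p.1)) :
    Comp C (fun γ => ∑ i ∈ Finset.range (C.size γ), F i γ) := by
  intro k hk
  have hk1 : C.k ≤ k + 1 := by omega
  obtain ⟨c, P, hc⟩ := h (k + 1) hk1 (k + 2) le_rfl
  -- Register `k` holds the partial sum, register `k + 1` the summation variable.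
  refine ⟨.seq (.set k (.const 0)) (.seq (.set (k + 1) (.const 0))
    (.while (.sub (.reg 0) (.reg (k + 1)))
      (.seq c (.seq (.set k (.add (.reg k) (.reg (k + 2))))
        (.set (k + 1) (.add (.reg (k + 1)) (.const 1))))))),
    Polynomial.X * (P + 12) + 8, fun m γ hm => ?_⟩
  have hpos := C.pos
  let I : ℕ → Memory → Prop := fun i m' =>
    Agree k m m' ∧ m'.reg k = ∑ j ∈ Finset.range i, F j γ ∧ m'.reg (k + 1) = i
  obtain ⟨t, m', h1, h2, h3⟩ := exists_runs_while (x := k + 1) (n := C.size γ)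
    (T := P.eval (C.size γ) + 8) (I := I)
    (c := .seq c (.seq (.set k (.add (.reg k) (.reg (k + 2))))
        (.set (k + 1) (.add (.reg (k + 1)) (.const 1)))))
    (fun i m' hi => ⟨(hi.1.2 0 (by omega)).trans (C.reg_zero hm), hi.2.2⟩) (by
      rintro i m' hi ⟨ha, hs, hx⟩
      have hm' := C.rep_of_agree (ha.mono hk) hm
      obtain ⟨t, m'', g1, g2, g3, g4⟩ := hc m' (γ, i) ⟨hm', hx⟩
      refine ⟨_, _, g1.seq ((Runs.setReg _ _ _).seq (Runs.setReg _ _ _)), ?_, ?_, ?_, ?_⟩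
      · rw [C.reg_zero hm'] at g2
        simp only [Term.cost]
        omega
      · exact ((ha.trans (g3.mono (by omega))).trans (agree_setReg le_rfl _ _)).trans
          (agree_setReg (by omega) _ _)
      · rw [Memory.setReg_reg_of_ne _ (by omega), Memory.setReg_reg_self, Finset.sum_range_succ]
        simp only [Term.eval]
        rw [g4, g3.2 k (by omega), hs]
      · rw [Memory.setReg_reg_self]
        simp only [Term.eval]
        rw [Memory.setReg_reg_of_ne _ (by omega), g3.2 (k + 1) (by omega), hx])
    (C.size γ) 0 ((m.setReg k 0).setReg (k + 1) 0) (by omega)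
    ⟨(agree_setReg le_rfl _ _).trans (agree_setReg (by omega) _ _), by
      rw [Memory.setReg_reg_of_ne _ (by omega)]; simp, by simp⟩
  refine ⟨_, m', (Runs.setReg _ _ _).seq ((Runs.setReg _ _ _).seq h1), ?_, h3.1, h3.2.1⟩
  rw [C.reg_zero hm]
  simp only [Term.cost, Polynomial.eval_add, Polynomial.eval_mul, Polynomial.eval_X,
    Polynomial.eval_ofNat]
  linarith

theorem Comp.mulSize (h : Comp C F) : Comp C (fun γ => F γ * C.size γ) := by
  have := Comp.sum (C := C) (F := fun _ γ => F γ) fun k hk => h.wk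
  simpa [mul_comm] using this

open Classical in
/-- The truth value of a proposition as a number. -/
noncomputable def ind (p : Prop) : ℕ := if p then 1 else 0

theorem ind_of_true {p : Prop} (h : p) : ind p = 1 := if_pos h

theorem ind_of_false {p : Prop} (h : ¬p) : ind p = 0 := if_neg h

theorem ind_ne_zero {p : Prop} : ind p ≠ 0 ↔ p := by
  unfold ind
  split_ifs with h <;> simp [h]

/-- The predicate `p` can be decided in polynomial time. -/
def CompPred (C : Context Γ) (p : Γ → Prop) : Prop := Comp C (fun γ => ind (p γ))

variable {p q : Γ → Prop}

theorem Comp.ite {_ : DecidablePred p} (hp : CompPred C p) (h : Comp C F) (h' : Comp C F') :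
    Comp C (fun γ => if p γ then F γ else F' γ) := by
  intro k hk
  obtain ⟨c, P, hc⟩ := hp k hk
  obtain ⟨c₁, P₁, hc₁⟩ := h k hk
  obtain ⟨c₂, P₂, hc₂⟩ := h' k hk
  refine ⟨.seq c (.ite (.reg k) c₁ c₂), P + P₁ + P₂ + 2, fun m γ hm => ?_⟩
  obtain ⟨t, m', h1, h2, h3, h4⟩ := hc m γ hm
  have hm' := C.rep_of_agree (h3.mono hk) hm
  have h0 := h3.2 0 (C.pos.trans_le hk)
  by_cases hγ : p γ
  · obtain ⟨t', m'', g1, g2, g3, g4⟩ := hc₁ m' γ hm'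
    refine ⟨_, m'', h1.seq (.ite_true (by simpa [Term.eval, h4] using ind_ne_zero.2 hγ) g1), ?_,
      h3.trans g3, g4.trans (if_pos hγ).symm⟩
    rw [h0] at g2
    simp only [Term.cost, Polynomial.eval_add, Polynomial.eval_ofNat]
    omega
  · obtain ⟨t', m'', g1, g2, g3, g4⟩ := hc₂ m' γ hm'
    refine ⟨_, m'', h1.seq (.ite_false (by simpa [Term.eval, h4] using ind_of_false hγ) g1), ?_,
      h3.trans g3, g4.trans (if_neg hγ).symm⟩
    rw [h0] at g2
    simp only [Term.cost, Polynomial.eval_add, Polynomial.eval_ofNat]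
    omega

theorem CompPred.of_comp (h : Comp C F) (hF : ∀ γ, F γ = ind (p γ)) : CompPred C p := by
  have : F = fun γ => ind (p γ) := funext hF
  rwa [this] at h

theorem CompPred.congr (h : CompPred C p) (hpq : ∀ γ, p γ ↔ q γ) : CompPred C q := by
  have : p = q := funext fun γ => propext (hpq γ)
  rwa [this] at h

theorem CompPred.le (h : Comp C F) (h' : Comp C F') : CompPred C (fun γ => F γ ≤ F' γ) := by
  refine .of_comp ((Comp.const 1).sub (h.sub h')) fun γ => ?_
  by_cases hγ : F γ ≤ F' γ
  · rw [ind_of_true hγ]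
    omega
  · rw [ind_of_false hγ]
    omega

theorem CompPred.not (h : CompPred C p) : CompPred C (fun γ => ¬p γ) := by
  refine .of_comp ((Comp.const 1).sub h) fun γ => ?_
  by_cases hγ : p γ <;> simp [ind, hγ]

theorem CompPred.lt (h : Comp C F) (h' : Comp C F') : CompPred C (fun γ => F γ < F' γ) := by
  have := (CompPred.le h' h).not
  simpa only [not_le] using this

theorem CompPred.and (h : CompPred C p) (h' : CompPred C q) :
    CompPred C (fun γ => p γ ∧ q γ) := by
  refine .of_comp (((Comp.add h h')).sub (Comp.const 1)) fun γ => ?_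
  by_cases hγ : p γ <;> by_cases hγ' : q γ <;> simp [ind, hγ, hγ']

theorem CompPred.imp (h : CompPred C p) (h' : CompPred C q) :
    CompPred C (fun γ => p γ → q γ) := by
  refine (h.and h'.not).not.congr fun γ => ?_
  rw [not_and, not_not]

theorem CompPred.or (h : CompPred C p) (h' : CompPred C q) :
    CompPred C (fun γ => p γ ∨ q γ) := by
  refine (h.not.imp h').congr fun γ => ?_
  rw [← or_iff_not_imp_left]

theorem CompPred.eq (h : Comp C F) (h' : Comp C F') : CompPred C (fun γ => F γ = F' γ) := by
  refine ((CompPred.le h h').and (CompPred.le h' h)).congr fun γ => ?_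
  rw [le_antisymm_iff]

theorem CompPred.exists {p : ℕ → Γ → Prop}
    (h : ∀ k hk, CompPred (C.extend k hk) (fun x => p x.2 x.1)) :
    CompPred C (fun γ => ∃ i < C.size γ, p i γ) := by
  have h1 := CompPred.lt (Comp.const 0) (Comp.sum (C := C) (F := fun i γ => ind (p i γ)) h)
  refine h1.congr fun γ => ?_
  rw [Finset.sum_pos_iff]
  simp only [Finset.mem_range, Nat.pos_iff_ne_zero, ind_ne_zero]

theorem CompPred.forall {p : ℕ → Γ → Prop}
    (h : ∀ k hk, CompPred (C.extend k hk) (fun x => p x.2 x.1)) :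
    CompPred C (fun γ => ∀ i < C.size γ, p i γ) := by
  refine (CompPred.exists (p := fun i γ => ¬p i γ) fun k hk => (h k hk).not).not.congr
    fun γ => ?_
  push Not
  rfl

/-- The least `x < n` with `p x`, or `n` if there is none. -/
noncomputable def least (n : ℕ) (p : ℕ → Prop) : ℕ :=
  ∑ y ∈ Finset.range n, ind (∀ x < n, x ≤ y → ¬p x)

theorem least_spec {n : ℕ} {p : ℕ → Prop} (h : ∃ x < n, p x) :
    least n p < n ∧ p (least n p) := by
  classical
  suffices least n p = Nat.find h by
    rw [this]
    exact Nat.find_spec h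
  have hlt := (Nat.find_spec h).1
  rw [least, ← Finset.sum_subset (Finset.range_subset_range.2 hlt.le)]
  · rw [Finset.sum_congr rfl (g := fun _ => 1)]
    · simp
    · intro y hy
      refine ind_of_true fun x hx hxy hp => ?_
      exact Nat.find_min h (hxy.trans_lt (Finset.mem_range.1 hy)) ⟨hx, hp⟩
  · intro y _ hy
    refine ind_of_false fun hall => ?_
    exact hall _ hlt (by simpa using hy) (Nat.find_spec h).2

theorem Comp.least {p : ℕ → Γ → Prop}
    (h : ∀ k hk, CompPred (C.extend k hk) (fun x => p x.2 x.1)) :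
    Comp C (fun γ => least (C.size γ) (fun x => p x γ)) := by
  refine Comp.sum fun k hk => CompPred.forall (C := C.extend k hk)
    (p := fun x q => x ≤ q.2 → ¬p x q.1) fun k' hk' => ?_
  refine CompPred.imp (CompPred.le Comp.var Comp.var.wk) (CompPred.not ?_)
  have hk1 : C.k ≤ k' := by
    have : k + 1 ≤ k' := hk'
    omega
  exact (h k' hk1).comap (D := (C.extend k hk).extend k' hk') (fun x => (x.1.1, x.2)) le_rfl
    fun m x hx => ⟨hx.1.1, hx.2⟩

end Expressions
/-! ### Commands with bounded loops -/

section Commands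

/-- The transformation `f` of the memory is computed in polynomial time, up to registers from `k`
on, and it does not change the registers below `l`, which are the counters of the loops around
it. -/
def Cmd (l k : ℕ) (f : Memory → Memory) : Prop :=
  (∀ m, ∀ x < l, (f m).reg x = m.reg x) ∧
    ∃ (c : Program) (P : Polynomial ℕ), ∀ m γ, Agree k γ m →
      ∃ t m', Runs c m t m' ∧ t ≤ P.eval (m.reg 0) ∧ Agree k (f γ) m'

variable {l k : ℕ} {f g : Memory → Memory} {F F' : Memory → ℕ} {p : Memory → Prop}

theorem Cmd.id : Cmd l k (fun m => m) :=
  ⟨fun _ _ _ => rfl, .skip, 1, fun m γ h => ⟨1, m, .skip m, by simp, h⟩⟩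

theorem Cmd.setReg {hk : 0 < k} (x : ℕ) (hl : l ≤ x) (hF : Comp (Context.base k hk) F) :
    Cmd l k (fun m => m.setReg x (F m)) := by
  obtain ⟨c, P, hc⟩ := hF k le_rfl
  refine ⟨fun m y hy => m.setReg_reg_of_ne (by omega) _, .seq c (.set x (.reg k)), P + 2,
    fun m γ hm => ?_⟩
  obtain ⟨t, m', h1, h2, h3, h4⟩ := hc m γ hm
  refine ⟨_, _, h1.seq (Runs.setReg _ _ _), ?_, ?_⟩
  · simp only [Term.cost, Polynomial.eval_add, Polynomial.eval_ofNat]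
    omega
  · simp only [Term.eval, h4]
    exact (hm.trans h3).setReg _ _

theorem Cmd.setArr {hk : 0 < k} (a : ℕ) (hF : Comp (Context.base k hk) F)
    (hF' : Comp (Context.base k hk) F') : Cmd l k (fun m => m.setArr a (F m) (F' m)) := by
  obtain ⟨c, P, hc⟩ := hF k le_rfl
  obtain ⟨c', P', hc'⟩ := hF' (k + 1) k.le_succ
  refine ⟨fun m y _ => rfl, .seq c (.seq c' (.put a (.reg k) (.reg (k + 1)))), P + P' + 3,
    fun m γ hm => ?_⟩
  obtain ⟨t, m', h1, h2, h3, h4⟩ := hc m γ hm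
  obtain ⟨t', m'', h1', h2', h3', h4'⟩ := hc' m' γ (hm.trans h3)
  refine ⟨_, _, h1.seq (h1'.seq (Runs.setArr _ _ _ _)), ?_, ?_⟩
  · rw [h3.2 0 hk] at h2'
    simp only [Term.cost, Polynomial.eval_add, Polynomial.eval_ofNat]
    omega
  · simp only [Term.eval, h4', h3'.2 k k.lt_succ_self, h4]
    exact ((hm.trans h3).trans (h3'.mono k.le_succ)).setArr _ _ _

theorem Cmd.comp (hl : 0 < l) (hk : 0 < k) (hg : Cmd l k g) (hf : Cmd l k f) :
    Cmd l k (fun m => g (f m)) := by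
  obtain ⟨hf1, c, P, hc⟩ := hf
  obtain ⟨hg1, c', P', hc'⟩ := hg
  refine ⟨fun m x hx => (hg1 _ x hx).trans (hf1 m x hx), .seq c c', P + P', fun m γ hm => ?_⟩
  obtain ⟨t, m', h1, h2, h3⟩ := hc m γ hm
  obtain ⟨t', m'', h1', h2', h3'⟩ := hc' m' _ h3
  refine ⟨_, _, h1.seq h1', ?_, h3'⟩
  rw [h3.2 0 hk, hf1 γ 0 hl, ← hm.2 0 hk] at h2'
  rw [Polynomial.eval_add]
  omega

theorem Cmd.ite {hk : 0 < k} {_ : DecidablePred p} (hp : CompPred (Context.base k hk) p) (hf : Cmd l k f)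
    (hg : Cmd l k g) : Cmd l k (fun m => if p m then f m else g m) := by
  obtain ⟨hf1, c₁, P₁, hc₁⟩ := hf
  obtain ⟨hg1, c₂, P₂, hc₂⟩ := hg
  obtain ⟨c, P, hc⟩ := hp k le_rfl
  refine ⟨fun m x hx => ?_, .seq c (.ite (.reg k) c₁ c₂), P + P₁ + P₂ + 2, fun m γ hm => ?_⟩
  · show (if p m then f m else g m).reg x = _
    split_ifs
    · exact hf1 m x hx
    · exact hg1 m x hx
  obtain ⟨t, m', h1, h2, h3, h4⟩ := hc m γ hm
  have hm' := hm.trans h3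
  have h0 := h3.2 0 hk
  show ∃ t m', Runs _ m t m' ∧ _ ∧ Agree k (if p γ then f γ else g γ) m'
  by_cases hγ : p γ
  · obtain ⟨t', m'', g1, g2, g3⟩ := hc₁ m' γ hm'
    refine ⟨_, m'', h1.seq (.ite_true (by simpa [Term.eval, h4] using ind_ne_zero.2 hγ) g1), ?_,
      by rwa [if_pos hγ]⟩
    rw [h0] at g2
    simp only [Term.cost, Polynomial.eval_add, Polynomial.eval_ofNat]
    omega
  · obtain ⟨t', m'', g1, g2, g3⟩ := hc₂ m' γ hm'
    refine ⟨_, m'', h1.seq (.ite_false (by simpa [Term.eval, h4] using ind_of_false hγ) g1), ?_,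
      by rwa [if_neg hγ]⟩
    rw [h0] at g2
    simp only [Term.cost, Polynomial.eval_add, Polynomial.eval_ofNat]
    omega

/-- The memory after `i` rounds of the loop with counter `x` and body `f`. -/
def loop (x : ℕ) (f : Memory → Memory) : ℕ → Memory → Memory
  | 0, m => m.setReg x 0
  | i + 1, m => (f (loop x f i m)).setReg x (i + 1)

theorem loop_induction {x n : ℕ} {m : Memory} (I : ℕ → Memory → Prop) (h0 : I 0 (m.setReg x 0))
    (hI : ∀ i m, i < n → I i m → I (i + 1) ((f m).setReg x (i + 1))) : I n (loop x f n m) := by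
  have : ∀ i ≤ n, I i (loop x f i m) := by
    intro i
    induction i with
    | zero => exact fun _ => h0
    | succ i ih => exact fun hi => hI i _ hi (ih (by omega))
  exact this n le_rfl

theorem Cmd.loop {x : ℕ} (hx : 0 < x) (hxk : x < k) (hf : Cmd (x + 1) k f) :
    Cmd x k (fun m => loop x f (m.reg 0) m) := by
  obtain ⟨hf1, c, P, hc⟩ := hf
  have hreg : ∀ i m, ∀ y < x, (GraphBurning.loop x f i m).reg y = m.reg y := by
    intro i m y hy
    induction i with
    | zero => exact m.setReg_reg_of_ne (by omega) _
    | succ i ih =>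
      exact (Memory.setReg_reg_of_ne _ (by omega) _).trans ((hf1 _ y (by omega)).trans ih)
  have hregx : ∀ i m, (GraphBurning.loop x f i m).reg x = i := by
    intro i m
    cases i <;> exact Memory.setReg_reg_self _ _ _
  refine ⟨fun m => hreg _ m, .seq (.set x (.const 0)) (.while (.sub (.reg 0) (.reg x))
    (.seq c (.set x (.add (.reg x) (.const 1))))), Polynomial.X * (P + 8) + 6, fun m γ hm => ?_⟩
  have h0 : m.reg 0 = γ.reg 0 := hm.2 0 (by omega)
  obtain ⟨t, m', h1, h2, h3⟩ := exists_runs_while (x := x) (n := γ.reg 0)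
    (T := P.eval (γ.reg 0) + 4) (c := .seq c (.set x (.add (.reg x) (.const 1))))
    (I := fun i m' => Agree k (GraphBurning.loop x f i γ) m')
    (fun i m' h => ⟨(h.2 0 (by omega)).trans (hreg i γ 0 hx), (h.2 x hxk).trans (hregx i γ)⟩) (by
      intro i m' hi h
      obtain ⟨t, m'', g1, g2, g3⟩ := hc m' _ h
      refine ⟨_, _, g1.seq (Runs.setReg _ _ _), ?_, ?_⟩
      · rw [h.2 0 (by omega), hreg i γ 0 hx] at g2
        simp only [Term.cost]
        omega
      · have e : (Term.add (.reg x) (.const 1)).eval m'' = i + 1 := by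
          simp only [Term.eval]
          rw [g3.2 x hxk, hf1 _ x (by omega), hregx]
        rw [e]
        exact g3.setReg _ _)
    (γ.reg 0) 0 (m.setReg x 0) (by omega) (hm.setReg x 0)
  refine ⟨_, m', (Runs.setReg _ _ _).seq h1, ?_, h3⟩
  rw [h0]
  simp only [Term.cost, Polynomial.eval_add, Polynomial.eval_mul, Polynomial.eval_X,
    Polynomial.eval_ofNat]
  linarith

end Commands

/-! ### The algorithm -/

section Algorithm

theorem Comp.constMul {Γ : Type} {C : Context Γ} {F : Γ → ℕ} (a : ℕ) (h : Comp C F) :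
    Comp C (fun γ => a * F γ) := by
  induction a with
  | zero => simpa using Comp.const (C := C) 0
  | succ a ih => simpa only [Nat.add_mul, one_mul] using ih.add h

/-- The distance of `i` and `j`, if `A ((t * n + i) * n + j)` is the truth value of the statement
that the distance is at most `t`. -/
def distOf (n : ℕ) (A : ℕ → ℕ) (i j : ℕ) : ℕ :=
  ∑ t ∈ Finset.range n, (1 - A ((t * n + i) * n + j))

theorem Comp.distOf {Γ : Type} {C : Context Γ} {F F' : Γ → ℕ} (h : Comp C F) (h' : Comp C F') :
    Comp C (fun γ => distOf (C.size γ) (C.arr γ 2) (F γ) (F' γ)) :=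
  Comp.sum (F := fun t γ => 1 - C.arr γ 2 ((t * C.size γ + F γ) * C.size γ + F' γ))
    fun k hk => (Comp.const 1).sub (Comp.get (C := C.extend k hk) 2
      ((Comp.mulSize (C := C.extend k hk) ((Comp.mulSize (C := C.extend k hk) Comp.var).add
        h.wk)).add h'.wk))

/-- The vertex `u` is burnt at time `T`, if array `1` holds a list of `len` sources. -/
def IsBurntAt (n : ℕ) (A : ℕ → ℕ → ℕ) (len T u : ℕ) : Prop :=
  ∃ j < n, j < len ∧ distOf n (A 2) (A 1 j) u + j + 1 ≤ T

theorem CompPred.isBurntAt {Γ : Type} {C : Context Γ} {F₁ F₂ F₃ : Γ → ℕ} (h₁ : Comp C F₁)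
    (h₂ : Comp C F₂) (h₃ : Comp C F₃) :
    CompPred C (fun γ => IsBurntAt (C.size γ) (C.arr γ) (F₁ γ) (F₂ γ) (F₃ γ)) :=
  CompPred.exists (p := fun j γ => j < F₁ γ ∧
      distOf (C.size γ) (C.arr γ 2) (C.arr γ 1 j) (F₃ γ) + j + 1 ≤ F₂ γ)
    fun k hk => (CompPred.lt Comp.var h₁.wk).and
      (CompPred.le (((Comp.distOf (C := C.extend k hk) (Comp.get (C := C.extend k hk) 1 Comp.var)
        h₃.wk).add Comp.var).add (Comp.const 1)) h₂.wk)

/- The registers: `0` the number of vertices, `1` and `2` loop counters, `3` the length of the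
list of sources (or a loop counter, while distances are computed), `4` the flag that is raised when
a short burning sequence is found, `5` the pick, `6` and `7` the sources to be pushed, `8` the time
`11 * g / 4` for the guess `g`. The guess is one more than register `1`. -/

/-- The entry of the distance table for the index given by the registers `1`, `2`, `3`. -/
noncomputable def layerValue (m : Memory) : ℕ :=
  ind (m.reg 2 = m.reg 3 ∨ ∃ x < m.reg 0, 0 < m.reg 1 ∧
    0 < m.arr 2 (((m.reg 1 - 1) * m.reg 0 + m.reg 2) * m.reg 0 + x) ∧
    (x = m.reg 3 ∨ 0 < m.arr 0 (x * m.reg 0 + m.reg 3)))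

/-- Compute the distance table. -/
noncomputable def fillLayers (m : Memory) : Memory :=
  loop 1 (fun m => loop 2 (fun m => loop 3 (fun m =>
    m.setArr 2 ((m.reg 1 * m.reg 0 + m.reg 2) * m.reg 0 + m.reg 3) (layerValue m))
    (m.reg 0) m) (m.reg 0) m) (m.reg 0) m

theorem cmd_fillLayers : Cmd 1 9 fillLayers := by
  have h9 : 0 < 9 := by norm_num
  set C := Context.base 9 h9
  have hr : ∀ x < 9, Comp C (fun m => m.reg x) := fun x hx => Comp.reg x hx
  refine Cmd.loop (by norm_num) (by norm_num) (Cmd.loop (by norm_num) (by norm_num)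
    (Cmd.loop (by norm_num) (by norm_num) (Cmd.setArr (hk := h9) 2 ?_ ?_)))
  · exact (Comp.mulSize (C := C) ((Comp.mulSize (C := C) (hr 1 (by norm_num))).add
      (hr 2 (by norm_num)))).add (hr 3 (by norm_num))
  · refine CompPred.or (CompPred.eq (hr 2 (by norm_num)) (hr 3 (by norm_num)))
      (CompPred.exists (C := C) (p := fun x m => 0 < m.reg 1 ∧
        0 < m.arr 2 (((m.reg 1 - 1) * m.reg 0 + m.reg 2) * m.reg 0 + x) ∧
        (x = m.reg 3 ∨ 0 < m.arr 0 (x * m.reg 0 + m.reg 3))) fun k hk => ?_)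
    set D := C.extend k hk
    have hr' : ∀ x < 9, Comp D (fun p => p.1.reg x) := fun x hx => (hr x hx).wk
    exact (CompPred.lt (Comp.const 0) (hr' 1 (by norm_num))).and ((CompPred.lt (Comp.const 0)
      (Comp.get (C := D) 2 ((Comp.mulSize (C := D) ((Comp.mulSize (C := D)
        ((hr' 1 (by norm_num)).sub (Comp.const 1))).add (hr' 2 (by norm_num)))).add
        Comp.var))).and ((CompPred.eq Comp.var (hr' 3 (by norm_num))).or
        (CompPred.lt (Comp.const 0) (Comp.get (C := D) 0 ((Comp.mulSize (C := D) Comp.var).add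
          (hr' 3 (by norm_num)))))))

/-- The vertex `u` is burnt at time `T` by the list of sources in the memory `m`. -/
def Memory.IsBurnt (m : Memory) (T u : ℕ) : Prop :=
  IsBurntAt (m.reg 0) m.arr (m.reg 3) T u

/-- The distance of two vertices according to the distance table in the memory `m`. -/
def Memory.dist (m : Memory) (i j : ℕ) : ℕ :=
  distOf (m.reg 0) (m.arr 2) i j

open Classical in
/-- Push the vertex in register `x` to the list of sources. -/
noncomputable def pushCmd (x : ℕ) (m : Memory) : Memory :=
  if m.reg x < m.reg 0 ∧ ¬m.IsBurnt (m.reg 3) (m.reg x) then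
    (m.setArr 1 (m.reg 3) (m.reg x)).setReg 3 (m.reg 3 + 1)
  else m

theorem cmd_pushCmd {x : ℕ} (hx : x < 9) : Cmd 3 9 (pushCmd x) := by
  have h9 : 0 < 9 := by norm_num
  set C := Context.base 9 h9
  have hr : ∀ x < 9, Comp C (fun m => m.reg x) := fun x hx => Comp.reg x hx
  refine Cmd.ite (hk := h9) (p := fun m => m.reg x < m.reg 0 ∧ ¬m.IsBurnt (m.reg 3) (m.reg x))
    (f := fun m => (m.setArr 1 (m.reg 3) (m.reg x)).setReg 3 (m.reg 3 + 1))
    ((CompPred.lt (hr x hx) Comp.size).and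
    (CompPred.isBurntAt (C := C) (hr 3 (by norm_num)) (hr 3 (by norm_num)) (hr x hx)).not)
    ?_ Cmd.id
  exact Cmd.comp (by norm_num) h9 (g := fun m => m.setReg 3 (m.reg 3 + 1))
    (f := fun m => m.setArr 1 (m.reg 3) (m.reg x))
    (Cmd.setReg (hk := h9) 3 le_rfl ((hr 3 (by norm_num)).add (Comp.const 1)))
    (Cmd.setArr (hk := h9) 1 (hr 3 (by norm_num)) (hr x hx))

/-- The pick: a vertex that is farthest from vertex `0` among those that are not burnt at the time
given by register `8`. -/
noncomputable def pickValue (m : Memory) : ℕ :=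
  least (m.reg 0) fun v => ¬m.IsBurnt (m.reg 8) v ∧
    ∀ u < m.reg 0, ¬m.IsBurnt (m.reg 8) u → m.dist 0 u ≤ m.dist 0 v

/-- Two balls of radius `h` around `a` and `b` are enough to cover all vertices that are not burnt
at time `T` and have distance at most `2 * h` from `v`. -/
def IsCover (n : ℕ) (A : ℕ → ℕ → ℕ) (len T v h a b : ℕ) : Prop :=
  ∀ u < n, ¬IsBurntAt n A len T u → distOf n (A 2) u v ≤ 2 * h →
    distOf n (A 2) u a ≤ h ∨ distOf n (A 2) u b ≤ h

theorem CompPred.isCover {Γ : Type} {C : Context Γ} {F₁ F₂ F₃ F₄ F₅ F₆ : Γ → ℕ}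
    (h₁ : Comp C F₁) (h₂ : Comp C F₂) (h₃ : Comp C F₃) (h₄ : Comp C F₄) (h₅ : Comp C F₅)
    (h₆ : Comp C F₆) :
    CompPred C (fun γ => IsCover (C.size γ) (C.arr γ) (F₁ γ) (F₂ γ) (F₃ γ) (F₄ γ) (F₅ γ) (F₆ γ)) :=
  CompPred.forall (p := fun u γ => ¬IsBurntAt (C.size γ) (C.arr γ) (F₁ γ) (F₂ γ) u →
      distOf (C.size γ) (C.arr γ 2) u (F₃ γ) ≤ 2 * F₄ γ →
      distOf (C.size γ) (C.arr γ 2) u (F₅ γ) ≤ F₄ γ ∨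
        distOf (C.size γ) (C.arr γ 2) u (F₆ γ) ≤ F₄ γ)
    fun k hk => CompPred.imp (CompPred.isBurntAt (C := C.extend k hk) h₁.wk h₂.wk Comp.var).not
      (CompPred.imp (CompPred.le (Comp.distOf (C := C.extend k hk) Comp.var h₃.wk)
        (h₄.wk.constMul 2)) (CompPred.or
          (CompPred.le (Comp.distOf (C := C.extend k hk) Comp.var h₅.wk) h₄.wk)
          (CompPred.le (Comp.distOf (C := C.extend k hk) Comp.var h₆.wk) h₄.wk)))

/-- The vertices `a` and `b` may be chosen as sources for the pick in register `5`. -/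
def Memory.IsCover (m : Memory) (a b : ℕ) : Prop :=
  GraphBurning.IsCover (m.reg 0) m.arr (m.reg 3) (m.reg 8) (m.reg 5) (m.reg 1) a b

/-- There is time for a ball of radius `2 * (g - 1)` around the next source. -/
def IsEarly (m : Memory) : Prop :=
  2 * m.reg 1 + m.reg 3 + 1 ≤ m.reg 8

open Classical in
/-- The first source for the pick in register `5`. -/
noncomputable def firstValue (m : Memory) : ℕ :=
  if IsEarly m then m.reg 5 else least (m.reg 0) fun a => ∃ b < m.reg 0, m.IsCover a b

open Classical in
/-- The second source for the pick in register `5`, if register `6` holds the first one. -/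
noncomputable def secondValue (m : Memory) : ℕ :=
  if IsEarly m then m.reg 5 else least (m.reg 0) fun b => m.IsCover (m.reg 6) b

theorem comp_pickValue : Comp (Context.base 9 (by norm_num)) pickValue := by
  have h9 : 0 < 9 := by norm_num
  set C := Context.base 9 h9
  have hr : ∀ x < 9, Comp C (fun m => m.reg x) := fun x hx => Comp.reg x hx
  refine Comp.least (C := C) (p := fun v m => ¬m.IsBurnt (m.reg 8) v ∧
    ∀ u < m.reg 0, ¬m.IsBurnt (m.reg 8) u → m.dist 0 u ≤ m.dist 0 v) fun k hk => ?_
  set D := C.extend k hk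
  refine CompPred.and (CompPred.isBurntAt (C := D) (hr 3 (by norm_num)).wk
    (hr 8 (by norm_num)).wk Comp.var).not (CompPred.forall (C := D)
      (p := fun u x => ¬x.1.IsBurnt (x.1.reg 8) u → x.1.dist 0 u ≤ x.1.dist 0 x.2)
      fun k' hk' => ?_)
  set E := D.extend k' hk'
  exact CompPred.imp (CompPred.isBurntAt (C := E) (hr 3 (by norm_num)).wk.wk
    (hr 8 (by norm_num)).wk.wk Comp.var).not
    (CompPred.le (Comp.distOf (C := E) (Comp.const 0) Comp.var)
      (Comp.distOf (C := E) (Comp.const 0) Comp.var.wk))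

theorem compPred_isEarly : CompPred (Context.base 9 (by norm_num)) IsEarly :=
  CompPred.le ((((Comp.reg 1 (by norm_num)).constMul 2).add (Comp.reg 3 (by norm_num))).add
    (Comp.const 1)) (Comp.reg 8 (by norm_num))

theorem comp_firstValue : Comp (Context.base 9 (by norm_num)) firstValue := by
  have h9 : 0 < 9 := by norm_num
  set C := Context.base 9 h9
  have hr : ∀ x < 9, Comp C (fun m => m.reg x) := fun x hx => Comp.reg x hx
  refine Comp.ite (p := IsEarly) compPred_isEarly (hr 5 (by norm_num))
    (Comp.least (C := C) (p := fun a m => ∃ b < m.reg 0, m.IsCover a b) fun k hk => ?_)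
  set D := C.extend k hk
  refine CompPred.exists (C := D) (p := fun b x => x.1.IsCover x.2 b) fun k' hk' => ?_
  set E := D.extend k' hk'
  have hr' : ∀ x < 9, Comp E (fun p => p.1.1.reg x) := fun x hx => (hr x hx).wk.wk
  exact CompPred.isCover (C := E) (hr' 3 (by norm_num)) (hr' 8 (by norm_num))
    (hr' 5 (by norm_num)) (hr' 1 (by norm_num)) Comp.var.wk Comp.var

theorem comp_secondValue : Comp (Context.base 9 (by norm_num)) secondValue := by
  have h9 : 0 < 9 := by norm_num
  set C := Context.base 9 h9
  have hr : ∀ x < 9, Comp C (fun m => m.reg x) := fun x hx => Comp.reg x hx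
  refine Comp.ite (p := IsEarly) compPred_isEarly (hr 5 (by norm_num))
    (Comp.least (C := C) (p := fun b m => m.IsCover (m.reg 6) b) fun k hk => ?_)
  set D := C.extend k hk
  have hr' : ∀ x < 9, Comp D (fun p => p.1.reg x) := fun x hx => (hr x hx).wk
  exact CompPred.isCover (C := D) (hr' 3 (by norm_num)) (hr' 8 (by norm_num))
    (hr' 5 (by norm_num)) (hr' 1 (by norm_num)) (hr' 6 (by norm_num)) Comp.var

/-- One step of the greedy algorithm: pick a vertex and push two sources for it. -/
noncomputable def greedyStep (m : Memory) : Memory :=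
  let m₁ := m.setReg 5 (pickValue m)
  let m₂ := m₁.setReg 6 (firstValue m₁)
  let m₃ := m₂.setReg 7 (secondValue m₂)
  pushCmd 7 (pushCmd 6 m₃)

theorem cmd_greedyStep : Cmd 3 9 greedyStep := by
  have h9 : 0 < 9 := by norm_num
  have h3 : 0 < 3 := by norm_num
  exact Cmd.comp h3 h9 (g := fun m => pushCmd 7 (pushCmd 6 m))
    (Cmd.comp h3 h9 (cmd_pushCmd (by norm_num)) (cmd_pushCmd (by norm_num)))
    (Cmd.comp h3 h9 (g := fun m => m.setReg 7 (secondValue m))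
      (Cmd.setReg (hk := h9) 7 (by norm_num) comp_secondValue)
      (Cmd.comp h3 h9 (g := fun m => m.setReg 6 (firstValue m))
        (Cmd.setReg (hk := h9) 6 (by norm_num) comp_firstValue)
        (Cmd.setReg (hk := h9) 5 (by norm_num) comp_pickValue)))

/-- Push a vertex that is not burnt, if there is one. -/
noncomputable def padStep (m : Memory) : Memory :=
  pushCmd 6 (m.setReg 6 (least (m.reg 0) fun v => ¬m.IsBurnt (m.reg 3) v))

theorem cmd_padStep : Cmd 3 9 padStep := by
  have h9 : 0 < 9 := by norm_num
  set C := Context.base 9 h9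
  have hr : ∀ x < 9, Comp C (fun m => m.reg x) := fun x hx => Comp.reg x hx
  refine Cmd.comp (g := pushCmd 6) (by norm_num) h9 (cmd_pushCmd (by norm_num)) (Cmd.setReg (hk := h9)
    (F := fun m => least (m.reg 0) fun v => ¬m.IsBurnt (m.reg 3) v) 6 (by norm_num)
    (Comp.least (C := C) (p := fun v m => ¬m.IsBurnt (m.reg 3) v) fun k hk => ?_))
  exact (CompPred.isBurntAt (C := C.extend k hk) (hr 3 (by norm_num)).wk (hr 3 (by norm_num)).wk
    Comp.var).not

/-- The time `11 * g / 4`, computed as `2 * g + 3 * g / 4`. -/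
noncomputable def timeValue (m : Memory) : ℕ :=
  2 * (m.reg 1 + 1) + ∑ z ∈ Finset.range (m.reg 0), ind (4 * (z + 1) ≤ 3 * (m.reg 1 + 1))

theorem comp_timeValue : Comp (Context.base 9 (by norm_num)) timeValue := by
  have h9 : 0 < 9 := by norm_num
  set C := Context.base 9 h9
  have hr : Comp C (fun m => m.reg 1 + 1) := (Comp.reg 1 (by norm_num)).add (Comp.const 1)
  exact (hr.constMul 2).add (Comp.sum (C := C)
    (F := fun z m => ind (4 * (z + 1) ≤ 3 * (m.reg 1 + 1))) fun k hk =>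
      CompPred.le ((Comp.var.add (Comp.const 1)).constMul 4) (hr.wk.constMul 3))

/-- The greedy algorithm for the guess given by register `1`. -/
noncomputable def greedy (m : Memory) : Memory :=
  let m₁ := m.setReg 3 0
  let m₂ := m₁.setReg 8 (timeValue m₁)
  let m₃ := loop 2 greedyStep (m₂.reg 0) m₂
  let m₄ := loop 2 padStep (m₃.reg 0) m₃
  m₄.setReg 4 (ind (4 * m₄.reg 3 ≤ 11 * (m₄.reg 1 + 1)))

theorem cmd_greedy : Cmd 2 9 greedy := by
  have h9 : 0 < 9 := by norm_num
  have h2 : 0 < 2 := by norm_num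
  set C := Context.base 9 h9
  have hr : ∀ x < 9, Comp C (fun m => m.reg x) := fun x hx => Comp.reg x hx
  exact Cmd.comp h2 h9 (g := fun m => m.setReg 4 (ind (4 * m.reg 3 ≤ 11 * (m.reg 1 + 1))))
    (Cmd.setReg (hk := h9) 4 (by norm_num) (CompPred.le ((hr 3 (by norm_num)).constMul 4)
      (((hr 1 (by norm_num)).add (Comp.const 1)).constMul 11)))
    (Cmd.comp h2 h9 (g := fun m => loop 2 padStep (m.reg 0) m)
      (Cmd.loop (by norm_num) (by norm_num) cmd_padStep)
      (Cmd.comp h2 h9 (g := fun m => loop 2 greedyStep (m.reg 0) m)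
        (Cmd.loop (by norm_num) (by norm_num) cmd_greedyStep)
        (Cmd.comp h2 h9 (g := fun m => m.setReg 8 (timeValue m))
          (Cmd.setReg (hk := h9) 8 (by norm_num) comp_timeValue)
          (Cmd.setReg (hk := h9) 3 (by norm_num) (Comp.const 0)))))

/-- The greedy algorithm, unless the flag is raised. -/
noncomputable def tryGuess (m : Memory) : Memory :=
  if m.reg 4 = 0 then greedy m else m

/-- The algorithm: the greedy algorithm is run for the guesses `1`, `2`, … until it finds a
burning sequence that is short enough. -/
noncomputable def solve (m : Memory) : Memory :=
  let m₁ := (fillLayers m).setReg 3 0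
  let m₂ := m₁.setReg 4 0
  loop 1 tryGuess (m₂.reg 0) m₂

theorem cmd_solve : Cmd 1 9 solve := by
  have h9 : 0 < 9 := by norm_num
  refine Cmd.comp (g := fun m => loop 1 tryGuess (m.reg 0) m) (by norm_num) h9
    (Cmd.loop (by norm_num) (by norm_num) ?_)
    (Cmd.comp (g := fun m => m.setReg 4 0) (by norm_num) h9
      (Cmd.setReg (hk := h9) 4 (by norm_num) (Comp.const 0))
      (Cmd.comp (g := fun m => m.setReg 3 0) (by norm_num) h9
        (Cmd.setReg (hk := h9) 3 (by norm_num) (Comp.const 0)) cmd_fillLayers))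
  exact Cmd.ite (hk := h9) (p := fun m => m.reg 4 = 0)
    (CompPred.eq (Comp.reg 4 (by norm_num)) (Comp.const 0)) cmd_greedy Cmd.id

end Algorithm
/-! ### Correctness of the distance table -/

section Distances

variable {n : ℕ} {G : SimpleGraph (Fin n)}

theorem mul_add_injective {a b c d : ℕ} (hb : b < n) (hd : d < n) (h : a * n + b = c * n + d) :
    a = c ∧ b = d := by
  have hn : 0 < n := by omega
  have h1 : a = c := by
    have := congrArg (· / n) h
    simpa [Nat.mul_comm _ n, Nat.mul_add_div hn, Nat.div_eq_of_lt hb, Nat.div_eq_of_lt hd]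
      using this
  subst h1
  exact ⟨rfl, by omega⟩

theorem inputMemory_arr_pos (i j : Fin n) :
    0 < (inputMemory G).arr 0 (i * n + j) ↔ G.Adj i j := by
  simp only [inputMemory]
  constructor
  · intro h
    split_ifs at h with h'
    · obtain ⟨-, i', j', hadj, h'⟩ := h'
      obtain ⟨h1, h2⟩ := mul_add_injective j.2 j'.2 h'
      rwa [Fin.ext h1, Fin.ext h2]
    · simp at h
  · intro h
    rw [if_pos ⟨rfl, i, j, h, rfl⟩]
    exact one_pos

theorem dist_le_iff (hG : G.Connected) {t : ℕ} {i j : Fin n} :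
    G.dist i j ≤ t ↔ i = j ∨ ∃ x, 0 < t ∧ G.dist i x ≤ t - 1 ∧ (x = j ∨ G.Adj x j) := by
  constructor
  · intro h
    by_cases hij : i = j
    · exact .inl hij
    have h0 : 0 < G.dist i j := hG.pos_dist_of_ne hij
    obtain ⟨p, hp⟩ := hG.exists_walk_length_eq_dist j i
    rw [SimpleGraph.dist_comm] at hp
    cases p with
    | nil => exact absurd rfl hij
    | @cons _ x _ hx q =>
      refine .inr ⟨x, by omega, ?_, .inr hx.symm⟩
      have := dist_le q
      rw [Walk.length_cons] at hp
      rw [SimpleGraph.dist_comm]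
      omega
  · rintro (rfl | ⟨x, h0, hx, rfl | hxj⟩)
    · simp
    · omega
    · have := hG.dist_triangle (u := i) (v := x) (w := j)
      rw [dist_eq_one_iff_adj.2 hxj] at this
      omega

/-- The distance table is filled up to the index `Q`, and the input is still there. -/
def IsFilled (G : SimpleGraph (Fin n)) (Q : ℕ) (m : Memory) : Prop :=
  m.reg 0 = n ∧ (∀ i j : Fin n, 0 < m.arr 0 (i * n + j) ↔ G.Adj i j) ∧
    ∀ (t : ℕ) (i j : Fin n), t < n → (t * n + i) * n + j < Q →
      m.arr 2 ((t * n + i) * n + j) = ind (G.dist i j ≤ t)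

theorem IsFilled.setReg {Q : ℕ} {m : Memory} (h : IsFilled G Q m) {x : ℕ} (hx : x ≠ 0) (v : ℕ) :
    IsFilled G Q (m.setReg x v) :=
  ⟨(m.setReg_reg_of_ne hx.symm v).trans h.1, h.2⟩

theorem IsFilled.setArr (hG : G.Connected) {m : Memory} {t : ℕ} {i j : Fin n} (ht : t < n)
    (h : IsFilled G ((t * n + i) * n + j) m) (h1 : m.reg 1 = t) (h2 : m.reg 2 = i)
    (h3 : m.reg 3 = j) :
    IsFilled G ((t * n + i) * n + j + 1)
      (m.setArr 2 ((m.reg 1 * m.reg 0 + m.reg 2) * m.reg 0 + m.reg 3) (layerValue m)) := by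
  obtain ⟨h0, hadj, hA⟩ := h
  refine ⟨h0, ?_, ?_⟩
  · intro i j
    rw [Memory.setArr_arr, if_neg (by omega), hadj]
  intro t' i' j' ht' hQ
  rw [Memory.setArr_arr, h0, h1, h2, h3]
  split_ifs with hc
  · obtain ⟨hc1, hc2⟩ := mul_add_injective j'.2 j.2 hc.2
    obtain ⟨hc3, hc4⟩ := mul_add_injective i'.2 i.2 hc1
    obtain rfl := Fin.ext hc2
    obtain rfl := Fin.ext hc4
    subst hc3
    rw [layerValue]
    congr 1
    rw [eq_iff_iff, dist_le_iff hG, h0, h1, h2, h3, Fin.ext_iff]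
    -- The entries of the layer before have smaller indices.
    have hprev : ∀ x : Fin n, 0 < t' →
        (0 < m.arr 2 (((t' - 1) * n + i') * n + x) ↔ G.dist i' x ≤ t' - 1) := by
      intro x ht0
      rw [hA (t' - 1) i' x (by omega), Nat.pos_iff_ne_zero, ind_ne_zero]
      have e1 : (t' - 1) * n + n = t' * n := by
        obtain ⟨s, rfl⟩ := Nat.exists_eq_add_of_lt ht0
        simp only [zero_add, Nat.add_sub_cancel]
        ring
      have e2 : (t' - 1) * n + i' + 1 ≤ t' * n + i' := by have := i'.2; omega
      have e3 := Nat.mul_le_mul_right n e2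
      have e4 := x.2
      rw [Nat.add_mul _ 1, one_mul] at e3
      omega
    refine or_congr Iff.rfl ⟨?_, ?_⟩
    · rintro ⟨x, hx, ht0, hd, hxj⟩
      refine ⟨⟨x, hx⟩, ht0, (hprev ⟨x, hx⟩ ht0).1 hd, ?_⟩
      exact hxj.imp Fin.ext (hadj ⟨x, hx⟩ j').1
    · rintro ⟨x, ht0, hd, hxj⟩
      exact ⟨x, x.2, ht0, (hprev x ht0).2 hd, hxj.imp (congrArg Fin.val) (hadj x j').2⟩
  · refine hA t' i' j' ht' ?_
    simp only [true_and] at hc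
    omega

theorem isFilled_fillLayers (hG : G.Connected) {m : Memory} (hm : IsFilled G 0 m) :
    IsFilled G (n * n * n) (fillLayers m) := by
  unfold fillLayers
  rw [hm.1]
  refine (loop_induction (fun t m => IsFilled G (t * n * n) m ∧ m.reg 1 = t) ⟨?_, by simp⟩ ?_).1
  · simpa using hm.setReg one_ne_zero 0
  rintro t m ht ⟨hm, h1⟩
  refine ⟨IsFilled.setReg ?_ one_ne_zero _, by simp⟩
  rw [hm.1]
  have key := loop_induction (x := 2) (n := n) (m := m) (f := fun m => loop 3 (fun m =>
    m.setArr 2 ((m.reg 1 * m.reg 0 + m.reg 2) * m.reg 0 + m.reg 3) (layerValue m)) (m.reg 0) m)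
    (fun i m => IsFilled G ((t * n + i) * n) m ∧ m.reg 1 = t ∧ m.reg 2 = i)
    ⟨by simpa using hm.setReg two_ne_zero 0, by
      rw [m.setReg_reg_of_ne (by norm_num), h1], by simp⟩ ?_
  · convert key.1 using 1
    ring
  rintro i m hi ⟨hm, h1, h2⟩
  have key := loop_induction (x := 3) (n := n) (m := m) (f := fun m =>
    m.setArr 2 ((m.reg 1 * m.reg 0 + m.reg 2) * m.reg 0 + m.reg 3) (layerValue m))
    (fun j m => IsFilled G ((t * n + i) * n + j) m ∧ m.reg 1 = t ∧ m.reg 2 = i ∧ m.reg 3 = j)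
    ⟨by simpa using hm.setReg three_ne_zero 0, by
      rw [m.setReg_reg_of_ne (by norm_num), h1], by
      rw [m.setReg_reg_of_ne (by norm_num), h2], by simp⟩ ?_
  · rw [hm.1]
    refine ⟨IsFilled.setReg ?_ two_ne_zero _, ?_, by simp⟩
    · convert key.1 using 1
      ring
    · rw [Memory.setReg_reg_of_ne _ (by norm_num), key.2.1]
  rintro j m hj ⟨hm, h1, h2, h3⟩
  refine ⟨IsFilled.setReg ?_ three_ne_zero _, ?_, ?_, by simp⟩
  · exact IsFilled.setArr (i := ⟨i, hi⟩) (j := ⟨j, hj⟩) hG ht hm h1 h2 h3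
  · rw [Memory.setReg_reg_of_ne _ (by norm_num), Memory.setArr_reg, h1]
  · rw [Memory.setReg_reg_of_ne _ (by norm_num), Memory.setArr_reg, h2]

theorem IsFilled.distOf_eq (hG : G.Connected) {m : Memory} (hm : IsFilled G (n * n * n) m)
    (i j : Fin n) : distOf n (m.arr 2) i j = G.dist i j := by
  have hlt : G.dist i j < n := by
    classical
    obtain ⟨p, hp⟩ := hG.exists_walk_length_eq_dist i j
    have h1 := dist_le p.bypass
    have h2 := p.bypass_isPath.length_lt
    rw [Fintype.card_fin] at h2
    omega
  rw [distOf, ← Finset.card_range (G.dist i j), Finset.card_eq_sum_ones,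
    ← Finset.sum_subset (Finset.range_subset_range.2 hlt.le)]
  all_goals
    have hA : ∀ t < n, m.arr 2 ((t * n + i) * n + j) = ind (G.dist i j ≤ t) := by
      intro t ht
      refine hm.2.2 t i j ht ?_
      have e1 : t * n + i + 1 ≤ n * n := by
        have := Nat.mul_le_mul_right n (Nat.succ_le_of_lt ht)
        rw [Nat.succ_mul] at this
        have := i.2
        omega
      have e2 := Nat.mul_le_mul_right n e1
      rw [Nat.add_mul _ 1, one_mul] at e2
      have := j.2
      omega
  · refine Finset.sum_congr rfl fun t ht => ?_
    rw [Finset.mem_range] at ht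
    rw [hA t (ht.trans hlt), ind_of_false (by omega)]
  · intro t ht ht'
    rw [Finset.mem_range] at ht ht'
    rw [hA t ht, ind_of_true (by omega), Nat.sub_self]

end Distances
/-! ### Correctness of the algorithm -/

section Correctness

variable {n : ℕ} {G : SimpleGraph (Fin n)}

/-- The memory `m` holds a correct distance table and the list `S` of sources, and none of the
sources is burnt when its round starts. -/
structure Holds (G : SimpleGraph (Fin n)) (S : List (Fin n)) (m : Memory) : Prop where
  reg_zero : m.reg 0 = n
  dist_eq : ∀ i j : Fin n, distOf n (m.arr 2) i j = G.dist i j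
  length_eq : m.reg 3 = S.length
  arr_eq : ∀ (j : ℕ) (hj : j < S.length), m.arr 1 j = S[j]
  isValid : IsValid G S

theorem Holds.setReg {S : List (Fin n)} {m : Memory} (h : Holds G S m) {x : ℕ} (h0 : x ≠ 0)
    (h3 : x ≠ 3) (v : ℕ) : Holds G S (m.setReg x v) :=
  ⟨(m.setReg_reg_of_ne h0.symm v).trans h.1, h.2, (m.setReg_reg_of_ne h3.symm v).trans h.3, h.4,
    h.5⟩

theorem Holds.dist_val {S : List (Fin n)} {m : Memory} (h : Holds G S m) (i j : Fin n) :
    m.dist i j = G.dist i j := by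
  rw [Memory.dist, h.1, h.2]

theorem Holds.isBurnt_iff (hG : G.Connected) {S : List (Fin n)} {m : Memory} (h : Holds G S m)
    (T : ℕ) (u : Fin n) : m.IsBurnt T u ↔ u ∈ burnt G S T := by
  rw [mem_burnt_iff hG, Memory.IsBurnt, h.1, h.3]
  constructor
  · rintro ⟨j, -, hj, hT⟩
    rw [h.4 j hj, h.2] at hT
    exact ⟨j, S[j], List.getElem?_eq_getElem hj, hT⟩
  · rintro ⟨j, s, hs, hT⟩
    obtain ⟨hj, rfl⟩ := List.getElem?_eq_some_iff.1 hs
    have := h.5.length_le_card hG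
    rw [Fintype.card_fin] at this
    refine ⟨j, by omega, hj, ?_⟩
    rwa [h.4 j hj, h.2]

theorem Holds.pushCmd (hG : G.Connected) {S : List (Fin n)} {m : Memory} (h : Holds G S m)
    {x : ℕ} {v : Fin n} (hv : m.reg x = v) : Holds G (push G S v) (pushCmd x m) := by
  unfold GraphBurning.pushCmd push
  have hb := h.isBurnt_iff hG S.length v
  rw [hv, h.3, hb, h.1]
  by_cases hmem : v ∈ burnt G S S.length
  · rw [if_pos hmem, if_neg (by tauto)]
    exact h
  · rw [if_neg hmem, if_pos ⟨v.2, hmem⟩]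
    refine ⟨?_, ?_, ?_, ?_, h.5.append_singleton hmem⟩
    · rw [Memory.setReg_reg_of_ne _ (by norm_num), Memory.setArr_reg, h.1]
    · have : ((m.setArr 1 S.length v).setReg 3 (S.length + 1)).arr 2 = m.arr 2 := by
        funext j
        rw [Memory.setReg_arr, Memory.setArr_arr, if_neg (by omega)]
      rw [this]
      exact h.2
    · simp
    · intro j hj
      rw [Memory.setReg_arr, Memory.setArr_arr]
      by_cases hjS : j = S.length
      · subst hjS
        simp
      · have hj' : j < S.length := by
          rw [List.length_append, List.length_singleton] at hj
          omega
        rw [if_neg (by tauto), h.4 j hj', List.getElem_append_left hj']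

theorem pushCmd_of_le {m : Memory} {x : ℕ} (h : m.reg 0 ≤ m.reg x) : pushCmd x m = m :=
  if_neg fun h' => absurd h'.1 (not_lt.2 h)

theorem pushCmd_reg {m : Memory} {x y : ℕ} (hy : y ≠ 3) : (pushCmd x m).reg y = m.reg y := by
  unfold pushCmd
  split_ifs
  · rw [Memory.setReg_reg_of_ne _ hy, Memory.setArr_reg]
  · rfl

/-- Whatever register `x` contains, pushing keeps what is burnt already. -/
theorem Holds.exists_pushCmd (hG : G.Connected) {S : List (Fin n)} {m : Memory}
    (h : Holds G S m) (x : ℕ) : ∃ S', Holds G S' (GraphBurning.pushCmd x m) ∧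
      ∀ t, burnt G S t ⊆ burnt G S' t := by
  by_cases hx : m.reg x < n
  · exact ⟨_, h.pushCmd hG (v := ⟨m.reg x, hx⟩) rfl, fun t u hu => mem_burnt_push hG hu⟩
  · rw [pushCmd_of_le (by rw [h.1]; omega)]
    exact ⟨S, h, fun t => subset_rfl⟩

theorem Holds.pickValue_spec (hG : G.Connected) {S : List (Fin n)} {m : Memory}
    (h : Holds G S m) (hn : 0 < n) {u : Fin n} (hu : u ∉ burnt G S (m.reg 8)) :
    ∃ v : Fin n, pickValue m = v ∧ v ∉ burnt G S (m.reg 8) ∧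
      ∀ u ∉ burnt G S (m.reg 8), G.dist ⟨0, hn⟩ u ≤ G.dist ⟨0, hn⟩ v := by
  classical
  have hd : ∀ j : Fin n, m.dist 0 j = G.dist ⟨0, hn⟩ j := fun j => h.dist_val ⟨0, hn⟩ j
  obtain ⟨v, hv, hmax⟩ := (Finset.univ.filter fun u => u ∉ burnt G S (m.reg 8)).exists_max_image
    (fun u => G.dist ⟨0, hn⟩ u) ⟨u, by simpa using hu⟩
  have hex : ∃ v < m.reg 0, ¬m.IsBurnt (m.reg 8) v ∧
      ∀ u < m.reg 0, ¬m.IsBurnt (m.reg 8) u → m.dist 0 u ≤ m.dist 0 v := by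
    refine ⟨v, h.1 ▸ v.2, ?_, fun w hw hwb => ?_⟩
    · rw [h.isBurnt_iff hG]
      simpa using hv
    · rw [h.1] at hw
      have hwb' := (h.isBurnt_iff hG _ ⟨w, hw⟩).not.1 hwb
      have := hmax ⟨w, hw⟩ (by simpa using hwb')
      rwa [hd v, show m.dist 0 w = _ from hd ⟨w, hw⟩]
  obtain ⟨h1, h2, h3⟩ := least_spec hex
  change pickValue m < _ at h1
  change ¬m.IsBurnt _ (pickValue m) at h2
  change ∀ u < m.reg 0, ¬m.IsBurnt (m.reg 8) u → m.dist 0 u ≤ m.dist 0 (pickValue m) at h3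
  rw [h.1] at h1
  refine ⟨⟨pickValue m, h1⟩, rfl, (h.isBurnt_iff hG _ ⟨_, h1⟩).not.1 h2, fun u hu => ?_⟩
  have := h3 u (h.1 ▸ u.2) ((h.isBurnt_iff hG _ u).not.2 hu)
  rwa [hd u, show m.dist 0 (pickValue m) = _ from hd ⟨_, h1⟩] at this

theorem Holds.isCover_iff (hG : G.Connected) {S : List (Fin n)} {m : Memory} (h : Holds G S m)
    {v : Fin n} (hv : m.reg 5 = v) (a b : Fin n) :
    m.IsCover a b ↔ ∀ u ∉ burnt G S (m.reg 8), G.dist u v ≤ 2 * m.reg 1 →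
      G.dist u a ≤ m.reg 1 ∨ G.dist u b ≤ m.reg 1 := by
  have hd : ∀ i j : Fin n, distOf (m.reg 0) (m.arr 2) i j = G.dist i j := h.dist_val
  have hb := h.isBurnt_iff hG (m.reg 8)
  unfold Memory.IsCover IsCover
  constructor
  · intro H u hu
    have := H u (h.1 ▸ u.2) ((hb u).not.2 hu)
    rwa [hv, hd, hd, hd] at this
  · intro H u hu hub
    rw [h.1] at hu
    have := H ⟨u, hu⟩ ((hb ⟨u, hu⟩).not.1 hub)
    rwa [← hd, ← hd, ← hd, ← hv] at this

/-- The values pushed by the greedy step are an admissible choice for the pick, as there is one in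
a cactus. -/
theorem Holds.isChoice (hG : G.Connected) (hc : IsCactus G) (hn : 0 < n) {S : List (Fin n)}
    {m : Memory} (h : Holds G S m) {g : ℕ} (h1 : m.reg 1 + 1 = g) (h8 : m.reg 8 = 11 * g / 4)
    {v : Fin n} (h5 : m.reg 5 = v)
    (hmax : ∀ u ∉ burnt G S (11 * g / 4), G.dist ⟨0, hn⟩ u ≤ G.dist ⟨0, hn⟩ v) :
    ∃ x₁ x₂ : Fin n, firstValue m = x₁ ∧
      secondValue (m.setReg 6 (firstValue m)) = x₂ ∧ IsChoice G g S v x₁ x₂ := by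
  have hg : m.reg 1 = g - 1 := by omega
  unfold IsChoice
  have hE : ∀ y, IsEarly (m.setReg 6 y) ↔ 2 * (g - 1) + S.length + 1 ≤ 11 * g / 4 := by
    intro y
    unfold IsEarly
    rw [Memory.setReg_reg_of_ne _ (by norm_num), Memory.setReg_reg_of_ne _ (by norm_num),
      Memory.setReg_reg_of_ne _ (by norm_num), h.3, h8, hg]
  have hE' : IsEarly m ↔ 2 * (g - 1) + S.length + 1 ≤ 11 * g / 4 := by
    unfold IsEarly
    rw [h.3, h8, hg]
  by_cases he : 2 * (g - 1) + S.length + 1 ≤ 11 * g / 4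
  · refine ⟨v, v, ?_, ?_, ?_⟩
    · rw [firstValue, if_pos (hE'.2 he), h5]
    · rw [secondValue, if_pos ((hE _).2 he), Memory.setReg_reg_of_ne _ (by norm_num), h5]
    · rw [if_pos he]
      exact ⟨rfl, rfl⟩
  have e1 : firstValue m = least (m.reg 0) fun a => ∃ b < m.reg 0, m.IsCover a b := by
    rw [firstValue, if_neg (hE'.not.2 he)]
  obtain ⟨y₁, y₂, hy⟩ := hc.exists_two_balls hG ⟨0, hn⟩ v (g - 1)
  have hex : ∃ a < m.reg 0, ∃ b < m.reg 0, m.IsCover a b := by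
    refine ⟨y₁, h.1 ▸ y₁.2, y₂, h.1 ▸ y₂.2, ?_⟩
    rw [h.isCover_iff hG h5, h8, hg]
    exact fun u hu => hy u (hmax u hu)
  obtain ⟨hlt, hcov⟩ := least_spec hex
  rw [← e1] at hlt hcov
  set m' := m.setReg 6 (firstValue m) with hm'
  have h' : Holds G S m' := h.setReg (by norm_num) (by norm_num) _
  have h0' : m'.reg 0 = m.reg 0 := m.setReg_reg_of_ne (by norm_num) _
  have h1' : m'.reg 1 = g - 1 := (m.setReg_reg_of_ne (by norm_num) _).trans hg
  have h5' : m'.reg 5 = v := (m.setReg_reg_of_ne (by norm_num) _).trans h5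
  have h8' : m'.reg 8 = 11 * g / 4 := (m.setReg_reg_of_ne (by norm_num) _).trans h8
  have h6' : m'.reg 6 = firstValue m := m.setReg_reg_self _ _
  have e2 : secondValue m' = least (m'.reg 0) fun b => m'.IsCover (m'.reg 6) b := by
    rw [secondValue, if_neg ((hE _).not.2 he)]
  have hex' : ∃ b < m'.reg 0, m'.IsCover (m'.reg 6) b := by
    obtain ⟨b, hb, hcb⟩ := hcov
    refine ⟨b, h0'.symm ▸ hb, ?_⟩
    rw [h.1] at hlt hb
    have k1 := (h.isCover_iff hG h5 ⟨_, hlt⟩ ⟨b, hb⟩).1 hcb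
    rw [h8, hg, ← h8', ← h1'] at k1
    rw [h6']
    exact (h'.isCover_iff hG h5' ⟨_, hlt⟩ ⟨b, hb⟩).2 k1
  obtain ⟨hlt', hcov'⟩ := least_spec hex'
  rw [← e2] at hlt' hcov'
  rw [h6'] at hcov'
  rw [h.1] at hlt
  rw [h'.1] at hlt'
  have k1 := (h'.isCover_iff hG h5' ⟨_, hlt⟩ ⟨_, hlt'⟩).1 hcov'
  rw [h8', h1'] at k1
  refine ⟨⟨_, hlt⟩, ⟨_, hlt'⟩, rfl, rfl, ?_⟩
  rw [if_neg he]
  exact k1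

theorem greedyStep_reg {m : Memory} {y : ℕ} (h3 : y ≠ 3) (h5 : y ≠ 5) (h6 : y ≠ 6)
    (h7 : y ≠ 7) : (greedyStep m).reg y = m.reg y := by
  simp only [greedyStep]
  rw [pushCmd_reg h3, pushCmd_reg h3, Memory.setReg_reg_of_ne _ h7,
    Memory.setReg_reg_of_ne _ h6, Memory.setReg_reg_of_ne _ h5]

/-- If the guess is the burning number, a greedy step counts as one more pick. -/
theorem Holds.exists_greedyStep (hG : G.Connected) (hc : IsCactus G) (hn : 0 < n) {g : ℕ}
    {S : List (Fin n)} {m : Memory} (h : Holds G S m) (h1 : m.reg 1 + 1 = g)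
    (h8 : m.reg 8 = 11 * g / 4) {j : ℕ} (hS : g = burningNumber G → GreedyState G g j S) :
    ∃ S', Holds G S' (greedyStep m) ∧ (g = burningNumber G → GreedyState G g (j + 1) S') := by
  set m₁ := m.setReg 5 (pickValue m) with hm₁
  set m₂ := m₁.setReg 6 (firstValue m₁) with hm₂
  set m₃ := m₂.setReg 7 (secondValue m₂) with hm₃
  have hstep : greedyStep m = GraphBurning.pushCmd 7 (GraphBurning.pushCmd 6 m₃) := rfl
  have hh₁ : Holds G S m₁ := h.setReg (by norm_num) (by norm_num) _
  have hh₃ : Holds G S m₃ :=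
    (hh₁.setReg (by norm_num) (by norm_num) _).setReg (by norm_num) (by norm_num) _
  rw [hstep]
  by_cases hall : ∀ u, u ∈ burnt G S (11 * g / 4)
  · obtain ⟨S₁, hS₁, hsub₁⟩ := hh₃.exists_pushCmd hG 6
    obtain ⟨S₂, hS₂, hsub₂⟩ := hS₁.exists_pushCmd hG 7
    exact ⟨S₂, hS₂, fun _ => .inl fun u => hsub₂ _ (hsub₁ _ (hall u))⟩
  · push Not at hall
    obtain ⟨u, hu⟩ := hall
    rw [← h8] at hu
    obtain ⟨v, hv, hvb, hmax⟩ := h.pickValue_spec hG hn hu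
    rw [h8] at hvb hmax
    obtain ⟨x₁, x₂, hx₁, hx₂, hch⟩ := hh₁.isChoice hG hc hn (g := g)
      ((congrArg (· + 1) (m.setReg_reg_of_ne (by norm_num) _)).trans h1)
      ((m.setReg_reg_of_ne (by norm_num) _).trans h8)
      ((m.setReg_reg_self _ _).trans hv) hmax
    have h6 : m₃.reg 6 = x₁ := by
      rw [hm₃, Memory.setReg_reg_of_ne _ (by norm_num), hm₂, Memory.setReg_reg_self, hx₁]
    have h7 : (GraphBurning.pushCmd 6 m₃).reg 7 = x₂ := by
      rw [pushCmd_reg (by norm_num), hm₃, Memory.setReg_reg_self, hm₂, hx₂]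
    refine ⟨_, (hh₃.pushCmd hG h6).pushCmd hG h7, ?_⟩
    rintro rfl
    exact (hS rfl).push_push hG hvb hch

theorem padStep_reg {m : Memory} {y : ℕ} (h3 : y ≠ 3) (h6 : y ≠ 6) :
    (padStep m).reg y = m.reg y := by
  rw [padStep, pushCmd_reg h3, Memory.setReg_reg_of_ne _ h6]

theorem Holds.exists_padStep (hG : G.Connected) {S : List (Fin n)} {m : Memory}
    (h : Holds G S m) {j : ℕ} (hS : j ≤ S.length ∨ ∀ u, u ∈ burnt G S S.length) :
    ∃ S', Holds G S' (padStep m) ∧ (∀ t, burnt G S t ⊆ burnt G S' t) ∧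
      (j + 1 ≤ S'.length ∨ ∀ u, u ∈ burnt G S' S'.length) := by
  set v := least (m.reg 0) fun v => ¬m.IsBurnt (m.reg 3) v with hv
  have h' : Holds G S (m.setReg 6 v) := h.setReg (by norm_num) (by norm_num) _
  have hstep : padStep m = GraphBurning.pushCmd 6 (m.setReg 6 v) := rfl
  rw [hstep]
  by_cases hall : ∀ u, u ∈ burnt G S S.length
  · obtain ⟨S', hS', hsub⟩ := h'.exists_pushCmd hG 6
    refine ⟨S', hS', hsub, .inr fun u => ?_⟩
    have hle : S'.length ≤ S.length := hS'.5.length_le fun u => hsub _ (hall u)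
    by_cases hx : (m.setReg 6 v).reg 6 < n
    · have hh := h'.pushCmd hG (x := 6) (v := ⟨_, hx⟩) rfl
      have hl := length_le_length_push (G := G) S ⟨_, hx⟩
      rw [← hh.3, hS'.3] at hl
      rw [le_antisymm hle hl]
      exact hsub _ (hall u)
    · rw [pushCmd_of_le (by rw [h'.1]; omega)] at hS'
      rw [← hS'.3, h'.3]
      exact hsub _ (hall u)
  · push Not at hall
    obtain ⟨u, hu⟩ := hall
    obtain ⟨hlt, hnb⟩ := least_spec (n := m.reg 0) (p := fun v => ¬m.IsBurnt (m.reg 3) v)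
      ⟨u, h.1 ▸ u.2, by rwa [h.isBurnt_iff hG, h.3]⟩
    rw [← hv] at hlt hnb
    rw [h.1] at hlt
    rw [h.isBurnt_iff hG _ ⟨v, hlt⟩, h.3] at hnb
    refine ⟨push G S ⟨v, hlt⟩, h'.pushCmd hG (m.setReg_reg_self _ _),
      fun t u hu => mem_burnt_push hG hu, .inl ?_⟩
    rw [push, if_neg hnb, List.length_append, List.length_singleton]
    have := hS.resolve_right fun hall => hu (hall u)
    omega

theorem timeValue_eq {m : Memory} (h : m.reg 1 < m.reg 0) :
    timeValue m = 11 * (m.reg 1 + 1) / 4 := by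
  have : ∑ z ∈ Finset.range (m.reg 0), ind (4 * (z + 1) ≤ 3 * (m.reg 1 + 1)) =
      3 * (m.reg 1 + 1) / 4 := by
    rw [← Finset.card_range (3 * (m.reg 1 + 1) / 4), Finset.card_eq_sum_ones,
      ← Finset.sum_subset (Finset.range_subset_range.2 (by omega : 3 * (m.reg 1 + 1) / 4 ≤ _))]
    · refine Finset.sum_congr rfl fun z hz => ind_of_true ?_
      rw [Finset.mem_range] at hz
      omega
    · intro z _ hz
      rw [Finset.mem_range] at hz
      exact ind_of_false (by omega)
  rw [timeValue, this]
  omega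

/-- The greedy algorithm finds a burning sequence; if the guess is the burning number, the flag is
raised. -/
theorem Holds.greedy (hG : G.Connected) (hc : IsCactus G) {S₀ : List (Fin n)} {m : Memory}
    (h : Holds G S₀ m) (h1 : m.reg 1 < n) :
    ∃ S, Holds G S (GraphBurning.greedy m) ∧ IsBurningSequence G S ∧
      (GraphBurning.greedy m).reg 4 = ind (4 * S.length ≤ 11 * (m.reg 1 + 1)) ∧
      (m.reg 1 + 1 = burningNumber G → 4 * S.length ≤ 11 * (m.reg 1 + 1)) := by
  have hn : 0 < n := by omega
  set m₁ := m.setReg 3 0 with hm₁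
  set m₂ := m₁.setReg 8 (timeValue m₁) with hm₂
  set m₃ := loop 2 greedyStep (m₂.reg 0) m₂ with hm₃
  set m₄ := loop 2 padStep (m₃.reg 0) m₃ with hm₄
  have hgr : GraphBurning.greedy m =
    m₄.setReg 4 (ind (4 * m₄.reg 3 ≤ 11 * (m₄.reg 1 + 1))) := rfl
  have hh₁ : Holds G [] m₁ :=
    ⟨(m.setReg_reg_of_ne (by norm_num) _).trans h.1, h.2, by simp [hm₁], by simp, isValid_nil⟩
  have hr₁ : m₁.reg 1 = m.reg 1 := m.setReg_reg_of_ne (by norm_num) _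
  have hh₂ : Holds G [] m₂ := hh₁.setReg (by norm_num) (by norm_num) _
  have hr₂ : m₂.reg 1 = m.reg 1 := (m₁.setReg_reg_of_ne (by norm_num) _).trans hr₁
  have h8 : m₂.reg 8 = 11 * (m.reg 1 + 1) / 4 := by
    rw [hm₂, Memory.setReg_reg_self, timeValue_eq (by rw [hr₁, hh₁.1]; exact h1), hr₁]
  have key₃ : m₃.reg 1 = m.reg 1 ∧ m₃.reg 8 = 11 * (m.reg 1 + 1) / 4 ∧ ∃ S, Holds G S m₃ ∧
      (m.reg 1 + 1 = burningNumber G → GreedyState G (m.reg 1 + 1) n S) := by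
    rw [hm₃, hh₂.1]
    refine loop_induction (fun j m' => m'.reg 1 = m.reg 1 ∧ m'.reg 8 = 11 * (m.reg 1 + 1) / 4 ∧
      ∃ S, Holds G S m' ∧ (m.reg 1 + 1 = burningNumber G → GreedyState G (m.reg 1 + 1) j S))
      ⟨?_, ?_, [], hh₂.setReg (by norm_num) (by norm_num) _, fun _ => greedyState_nil⟩ ?_
    · rw [Memory.setReg_reg_of_ne _ (by norm_num), hr₂]
    · rw [Memory.setReg_reg_of_ne _ (by norm_num), h8]
    · rintro j m' hj ⟨g1, g8, S, hS, hgS⟩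
      obtain ⟨S', hS', hgS'⟩ := hS.exists_greedyStep hG hc hn (by rw [g1]) g8 hgS
      refine ⟨?_, ?_, S', hS'.setReg (by norm_num) (by norm_num) _, hgS'⟩
      · rw [Memory.setReg_reg_of_ne _ (by norm_num),
          greedyStep_reg (by norm_num) (by norm_num) (by norm_num) (by norm_num), g1]
      · rw [Memory.setReg_reg_of_ne _ (by norm_num),
          greedyStep_reg (by norm_num) (by norm_num) (by norm_num) (by norm_num), g8]
  obtain ⟨hr₃, -, S₃, hS₃, hgS₃⟩ := key₃
  have hb : burningNumber G ≤ n := by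
    simpa using burningNumber_le_card hG
  have key₄ : m₄.reg 1 = m.reg 1 ∧ ∃ S, Holds G S m₄ ∧
      (m.reg 1 + 1 = burningNumber G → ∀ u, u ∈ burnt G S (11 * (m.reg 1 + 1) / 4)) ∧
      (n ≤ S.length ∨ ∀ u, u ∈ burnt G S S.length) := by
    rw [hm₄, hS₃.1]
    refine loop_induction (fun j m' => m'.reg 1 = m.reg 1 ∧ ∃ S, Holds G S m' ∧
      (m.reg 1 + 1 = burningNumber G → ∀ u, u ∈ burnt G S (11 * (m.reg 1 + 1) / 4)) ∧
      (j ≤ S.length ∨ ∀ u, u ∈ burnt G S S.length))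
      ⟨?_, S₃, hS₃.setReg (by norm_num) (by norm_num) _, ?_, .inl (Nat.zero_le _)⟩ ?_
    · rw [Memory.setReg_reg_of_ne _ (by norm_num), hr₃]
    · intro hg u
      have := hgS₃ hg
      rw [hg] at this ⊢
      exact this.forall_mem hG hb u
    · rintro j m' hj ⟨g1, S, hS, hgS, hjS⟩
      obtain ⟨S', hS', hsub, hjS'⟩ := hS.exists_padStep hG hjS
      refine ⟨?_, S', hS'.setReg (by norm_num) (by norm_num) _,
        fun hg u => hsub _ (hgS hg u), hjS'⟩
      rw [Memory.setReg_reg_of_ne _ (by norm_num), padStep_reg (by norm_num) (by norm_num), g1]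
  obtain ⟨hr₄, S, hS, hgS, hnS⟩ := key₄
  rw [hgr]
  refine ⟨S, hS.setReg (by norm_num) (by norm_num) _, ⟨hS.5, ?_⟩, ?_, ?_⟩
  · refine Set.eq_univ_of_forall fun u => ?_
    by_contra hu
    -- Otherwise the sources and `u` would be `n + 1` distinct vertices.
    have hnS' := hnS.resolve_right fun hall => hu (hall u)
    have := (hS.5.append_singleton hu).length_le_card hG
    rw [Fintype.card_fin, List.length_append, List.length_singleton] at this
    omega
  · rw [Memory.setReg_reg_self, hS.3, hr₄]
  · intro hg
    have := hS.5.length_le (hgS hg)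
    omega

theorem one_le_burningNumber (hn : 0 < n) (G : SimpleGraph (Fin n)) : 1 ≤ burningNumber G := by
  obtain ⟨S, hS, hb⟩ := exists_isBurningSequence_length_eq G
  by_contra! h0
  have : S.length = 0 := by omega
  have h1 := hS.2
  rw [this] at h1
  have : (⟨0, hn⟩ : Fin n) ∈ burnt G S 0 := h1 ▸ Set.mem_univ _
  exact this

/-- The result of the algorithm on a connected cactus. The outer loop keeps the invariant that the
flag is down only as long as all guesses so far have been smaller than the burning number. -/
theorem exists_solve (hG : G.Connected) (hc : IsCactus G) :
    ∃ S, Holds G S (solve (inputMemory G)) ∧ IsBurningSequence G S ∧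
      4 * S.length ≤ 11 * burningNumber G := by
  have hin : IsFilled G 0 (inputMemory G) :=
    ⟨by simp [inputMemory], inputMemory_arr_pos, fun _ _ _ _ h => absurd h (Nat.not_lt_zero _)⟩
  have hf := isFilled_fillLayers hG hin
  set m₁ := (fillLayers (inputMemory G)).setReg 3 0 with hm₁
  set m₂ := m₁.setReg 4 0 with hm₂
  have hsolve : solve (inputMemory G) = loop 1 tryGuess (m₂.reg 0) m₂ := rfl
  have hh₁ : Holds G [] m₁ := by
    have hf₁ := hf.setReg three_ne_zero 0
    exact ⟨hf₁.1, hf₁.distOf_eq hG, by simp [hm₁], by simp, isValid_nil⟩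
  have hh₂ : Holds G [] m₂ := hh₁.setReg (by norm_num) (by norm_num) _
  have hn : 0 < n := by
    obtain ⟨v⟩ := hG.nonempty
    exact v.pos
  have hb1 := one_le_burningNumber hn G
  have hb : burningNumber G ≤ n := by
    simpa using burningNumber_le_card hG
  have key : ∃ S, Holds G S (loop 1 tryGuess n m₂) ∧ (loop 1 tryGuess n m₂).reg 1 = n ∧
      ((loop 1 tryGuess n m₂).reg 4 = 0 → n < burningNumber G) ∧
      ((loop 1 tryGuess n m₂).reg 4 ≠ 0 →
        IsBurningSequence G S ∧ 4 * S.length ≤ 11 * burningNumber G) := by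
    refine loop_induction (fun y m => ∃ S, Holds G S m ∧ m.reg 1 = y ∧
      (m.reg 4 = 0 → y < burningNumber G) ∧
      (m.reg 4 ≠ 0 → IsBurningSequence G S ∧ 4 * S.length ≤ 11 * burningNumber G))
      ⟨[], hh₂.setReg one_ne_zero (by norm_num) _, by simp, fun _ => hb1, fun h => ?_⟩ ?_
    · refine absurd ?_ h
      rw [Memory.setReg_reg_of_ne _ (by norm_num), hm₂, Memory.setReg_reg_self]
    rintro y m hy ⟨S, hS, h1, h0, hflag⟩
    have h4 : ((tryGuess m).setReg 1 (y + 1)).reg 4 = (tryGuess m).reg 4 :=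
      Memory.setReg_reg_of_ne _ (by norm_num) _
    rw [h4]
    unfold tryGuess
    split_ifs with hm4
    · obtain ⟨S', hS', hburn, hr4, hgS'⟩ := hS.greedy hG hc (by rwa [h1])
      rw [h1] at hr4 hgS'
      have hyb := h0 hm4
      refine ⟨S', hS'.setReg one_ne_zero (by norm_num) _, by simp, fun h => ?_, fun h => ?_⟩
      · have : y + 1 ≠ burningNumber G := by
          intro hg
          rw [hr4, ind_of_true (hgS' hg)] at h
          exact one_ne_zero h
        omega
      · rw [hr4, ind_ne_zero] at h
        exact ⟨hburn, by omega⟩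
    · exact ⟨S, hS.setReg one_ne_zero (by norm_num) _, by simp, fun h => absurd h hm4, hflag⟩
  obtain ⟨S, hS, -, h0, hflag⟩ := key
  rw [hsolve, hh₂.1]
  have h4 : (loop 1 tryGuess n m₂).reg 4 ≠ 0 := fun h => absurd (h0 h) (not_lt.2 hb)
  exact ⟨S, hS, hflag h4⟩

end Correctness
end GraphBurning

theorem mainTheorem1 :
    ∃ (c : GraphBurning.Program) (P : Polynomial ℕ),
      ∀ (n : ℕ) (G : SimpleGraph (Fin n)), G.Connected → GraphBurning.IsCactus G →
        ∃ (t : ℕ) (m : GraphBurning.Memory) (S : List (Fin n)),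
          GraphBurning.Runs c (GraphBurning.inputMemory G) t m ∧
          t ≤ P.eval n ∧
          m.output = S.map (fun v : Fin n => (v : ℕ)) ∧
          GraphBurning.IsBurningSequence G S ∧
          (S.length : ℝ) ≤ 2.75 * (GraphBurning.burningNumber G : ℝ) := by
  obtain ⟨-, c, P, hcP⟩ := GraphBurning.cmd_solve
  refine ⟨.seq c (.set 0 (.reg 3)), P + 2, fun n G hG hc => ?_⟩
  obtain ⟨S, hS, hburn, hlen⟩ := GraphBurning.exists_solve hG hc
  obtain ⟨t, m, h1, h2, h3⟩ := hcP (GraphBurning.inputMemory G) _ (GraphBurning.Agree.refl 9 _)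
  have hin : (GraphBurning.inputMemory G).reg 0 = n := by simp [GraphBurning.inputMemory]
  have hr3 : m.reg 3 = S.length := (h3.2 3 (by norm_num)).trans hS.length_eq
  refine ⟨_, _, S, h1.seq (GraphBurning.Runs.setReg _ _ _), ?_, ?_, hburn, ?_⟩
  · rw [hin] at h2
    simp only [GraphBurning.Term.cost, Polynomial.eval_add, Polynomial.eval_ofNat]
    omega
  · rw [GraphBurning.Memory.output, GraphBurning.Memory.setReg_reg_self,
      GraphBurning.Memory.setReg_arr, GraphBurning.Term.eval, hr3, h3.1]
    refine List.ext_getElem (by simp) fun j hj hj' => ?_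
    rw [List.length_map] at hj'
    simp [hS.arr_eq j hj']
  · have : (4 * S.length : ℝ) ≤ 11 * GraphBurning.burningNumber G := by exact_mod_cast hlen
    linarith
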